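/- Theorem (two-dimensional Gross–Pitaevskii equation, resonant case). For $j\in\mathbb Z^2$ and $t\in K=[0,1)^2$ put $\vec P_j(t)=j+t$ and $p_j^2(t)=|\vec P_j(t)|^2$. For a $2\pi\mathbb Z^2$-periodic function $f$ with Fourier coefficients $f_m$ ($m\in\mathbb Z^2$) put $\|f\|_*=\sum_m|f_m|$. For $q\in\mathbb Z^2$, $k>0$, $\epsilon>0$ let $\chi_q(k,\epsilon)$ be the set of all $t\in K$ for which there is an index $j\in\mathbb Z^2$ with (1) $|\vec P_j(t)|=k$, (2) $|p_{j-q}^2(t)-p_j^2(t)|<\epsilon$, (3) $|p_j^2(t)-p_m^2(t)|>2\epsilon^6$ for all $m\ne j,\,j-q$. There are absolute constants $\epsilon_0>0$ and $C>0$ such that the following holds for every $0<\epsilon<\epsilon_0$. Let $V(x)=\sum_q v_qe^{i\langle q,x\rangle}$ be a real-valued trigonometric polynomial on $\mathbb R^2$ with $v_0=0$ and $\|V\|_*<\epsilon^9$. There is $k_1=k_1(V,\epsilon)$ such that for all $k>k_1$, all $q\in\mathbb Z^2$ with $|v_q|>\epsilon^{10}$, and all $\sigma\in\mathbb R$, $A\in\mathbb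 C$ with $|\sigma||A|^2<\epsilon^{11}$: let $t_0\in\chi_q(k,\epsilon)$ with $j$ satisfying (1)–(3) for $t_0$, and let $t\in K$ with $|t-t_0|<k^{-1}\epsilon^7$. Let $$\hat\lambda^+(t)=\tfrac12\big(p_j^2(t)+p_{j-q}^2(t)\big)+\tfrac12\sqrt{4|v_q|^2+(p_j^2(t)-p_{j-q}^2(t))^2}$$ be the larger eigenvalue of $\begin{pmatrix}p_j^2(t)&v_q\\ v_{-q}&p_{j-q}^2(t)\end{pmatrix}$, let $\hat E^+(t)$ be the orthogonal projection onto its eigenspace (rows and columns labelled by $j$, $j-q$), and let $\psi_{-1}(x)=\hat E^+_{j,j}+\hat E^+_{j-q,j}e^{-i\langle q,x\rangle}$. Then there are $\lambda\in\mathbb R$ and $u\in C^2(\mathbb R^2;\mathbb C)$ with $$-\Delta u+Vu+\sigma|u|^2u=\lambda u\quad\text{on }\mathbb R^2,$$ satisfying the quasi-periodic conditions $u(x+2\pi e_s)=e^{2\pi it_s}u(x)$, $\partial_su(x+2\pi e_s)=e^{2\pi it_s}\partial_su(x)$ ($s=1,2$), such that $$u(x)=Ae^{i\langle\vec P_j(t),x\rangle}\big(\psi_{-1}(x)+\hat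 u(x)\big),\qquad |\lambda-\hat\lambda^+(t)|\le C\epsilon^{11},$$ where $\hat u$ is continuous, $2\pi\mathbb Z^2$-periodic and $\|\hat u\|_*\le\epsilon$. Moreover, if $A\neq0$ and $2|p_m^2(t)-\hat\lambda^+(t)|\ge\epsilon^6$ for all $m\ne j,j-q$, then $u$ is not identically zero. -/

import Mathlib

open MeasureTheory
open scoped ENNReal

noncomputable section

namespace GrossPitaevskii

/-- The Euclidean plane. -/
abbrev Plane : Type := EuclideanSpace ℝ (Fin 2)

/-- The lattice `ℤ²` of indices. -/
abbrev Idx : Type := Fin 2 → ℤ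

/-- The lattice point `m ∈ ℤ²` as a vector of the plane. -/
def latticeVec (m : Idx) : Plane := WithLp.toLp 2 (fun s => (m s : ℝ))

/-- `P_j(t) = j + t`. -/
def P (j : Idx) (t : Plane) : Plane := latticeVec j + t

/-- The free eigenvalue `p_j²(t) = |P_j(t)|²`. -/
def pSq (j : Idx) (t : Plane) : ℝ := ‖P j t‖ ^ 2

/-- The plane wave `x ↦ e^{i⟨ξ, x⟩}`. -/
def planeWave (ξ x : Plane) : ℂ := Complex.exp (Complex.I * ((inner ℝ ξ x : ℝ) : ℂ))

/-- The elementary cell `K = [0,1)²` of quasimomenta. -/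
def dualCell : Set Plane := {t | ∀ s, t s ∈ Set.Ico (0 : ℝ) 1}

/-- The elementary cell of periods `Q = [0,2π]²`. -/
def periodCell : Set Plane := {x | ∀ s, x s ∈ Set.Icc (0 : ℝ) (2 * Real.pi)}

/-- The translation vector `2π e_s`. -/
def period (s : Fin 2) : Plane := EuclideanSpace.single s (2 * Real.pi)

/-- `f` has period `2π` in each coordinate. -/
def IsPeriodic (f : Plane → ℂ) : Prop := ∀ x s, f (x + period s) = f x

/-- The partial derivative `∂f/∂x_s`. -/
def partialDeriv (s : Fin 2) (f : Plane → ℂ) (x : Plane) : ℂ :=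
  fderiv ℝ f x (EuclideanSpace.single s 1)

/-- The quasi-periodic conditions with quasimomentum `t`, on the function and on its
first normal derivatives. -/
def IsQuasiPeriodic (t : Plane) (u : Plane → ℂ) : Prop :=
  ∀ x s,
    u (x + period s) = Complex.exp (2 * Real.pi * Complex.I * (t s : ℂ)) * u x ∧
    partialDeriv s u (x + period s) =
      Complex.exp (2 * Real.pi * Complex.I * (t s : ℂ)) * partialDeriv s u x

/-- The Fourier coefficient `(2π)⁻² ∫_Q f(x) e^{-i⟨m, x⟩} dx`. -/
def fourierCoef (f : Plane → ℂ) (m : Idx) : ℂ :=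
  (1 / (2 * Real.pi) ^ 2 : ℂ) * ∫ x in periodCell, f x * planeWave (-latticeVec m) x

/-- The norm `‖f‖_* = ∑_m |f_m|`, with value `∞` if the series diverges. -/
def starNorm (f : Plane → ℂ) : ℝ≥0∞ := ∑' m : Idx, ‖fourierCoef f m‖ₑ

/-- The trigonometric polynomial `V(x) = ∑_q v_q e^{i⟨q, x⟩}`. -/
def trigPoly (v : Idx →₀ ℂ) (x : Plane) : ℂ := v.sum fun q c => c * planeWave (latticeVec q) x

/-- The coefficients of a real trigonometric polynomial of mean zero. -/
structure IsRealMeanZero (v : Idx →₀ ℂ) : Prop where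
  real : ∀ q, v (-q) = (starRingEnd ℂ) (v q)
  mean_zero : v 0 = 0

/-- `P_j(t)` lies on the circle of radius `k`, `p_j²(t)` and `p_{j-q}²(t)` are `ε`-close, and
all the other free eigenvalues are farther than `2ε⁶` from `p_j²(t)`. -/
structure IsResonantIndex (q : Idx) (k ε : ℝ) (t : Plane) (j : Idx) : Prop where
  on_circle : ‖P j t‖ = k
  close : |pSq (j - q) t - pSq j t| < ε
  separated : ∀ m, m ≠ j → m ≠ j - q → 2 * ε ^ 6 < |pSq j t - pSq m t|

/-- The resonant set `χ_q(k, ε)`: all quasimomenta in `K` that have a resonant index. -/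
def resonantSet (q : Idx) (k ε : ℝ) : Set Plane :=
  {t | t ∈ dualCell ∧ ∃ j, IsResonantIndex q k ε t j}

/-- The upper eigenvalue `λ̂⁺(t)` of the model matrix
`((p_j²(t), v_q), (v_{-q}, p_{j-q}²(t)))`. -/
def lambdaPlus (v : Idx →₀ ℂ) (q j : Idx) (t : Plane) : ℝ :=
  (pSq j t + pSq (j - q) t) / 2 +
    Real.sqrt (4 * ‖v q‖ ^ 2 + (pSq j t - pSq (j - q) t) ^ 2) / 2

/-- The eigenvector of the model matrix for `λ̂⁺(t)`; its components correspond to the indices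
`j` and `j - q`. -/
def ePlus (v : Idx →₀ ℂ) (q j : Idx) (t : Plane) : Fin 2 → ℂ :=
  ![((pSq (j - q) t - lambdaPlus v q j t : ℝ) : ℂ), -v (-q)]

/-- The spectral projection `Ê⁺(t)`, that is, the orthogonal projection onto the line spanned by
the eigenvector. -/
def projPlus (v : Idx →₀ ℂ) (q j : Idx) (t : Plane) : Matrix (Fin 2) (Fin 2) ℂ :=
  (1 / ((∑ i, ‖ePlus v q j t i‖ ^ 2 : ℝ) : ℂ)) •
    Matrix.vecMulVec (ePlus v q j t) (star (ePlus v q j t))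

/-- `ψ_{-1}(x) = Ê⁺_{j,j} + Ê⁺_{j-q,j} e^{-i⟨q, x⟩}`. -/
def psi (v : Idx →₀ ℂ) (q j : Idx) (t x : Plane) : ℂ :=
  projPlus v q j t 0 0 + projPlus v q j t 1 0 * planeWave (-latticeVec q) x

/-- `u` is a classical solution of `-Δu + Vu + σ|u|²u = lam u` on the plane. -/
def IsSolution (V : Plane → ℂ) (σ lam : ℝ) (u : Plane → ℂ) : Prop :=
  ContDiff ℝ 2 u ∧
    ∀ x, -(Laplacian.laplacian u x) + V x * u x + σ * (‖u x‖ : ℂ) ^ 2 * u x = lam * u x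

end GrossPitaevskii

end

open GrossPitaevskii

/-! The substitution u = A a e^{i⟨P_j(t),x⟩} F(x) turns the equation into one for the Fourier
coefficients f of F in the convolution algebra ℓ¹(ℤ²): (p_m - λ̂⁺ - μ) f_m + (v∗f)_m + σ|Aa|²
(|F|²F)_m = 0, where p_m = p²_{j+m}(t). Here (a, b) is the unit eigenvector of the 2×2 model matrix
with a real. The first column of its projection is a·(a, b), so ψ_{-1} is a times the function with
coefficients a at 0 and b at -q, and the remainder of f, multiplied by a, becomes û.

The coefficient equation is solved by a Lyapunov–Schmidt contraction. Normalise the component of f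
along (a, b) to 1; the unknowns are β, the component along (-b̄, ā), and the part of f off the block
{0, -q}. Projecting on (a, b) gives the shift μ explicitly, projecting on (-b̄, ā) gives β after
division by the spectral gap, which is at least 2|v_q| ≥ 2ε¹⁰, and off the block one divides by p_m
- λ̂⁺, of modulus at least ε⁶/2. The sizes ε⁹ of V and ε¹¹ of the nonlinearity leave just enough
room, provided the off-block unknown is rescaled by 16ε² (`TwoModeResonance.exists_fixedPoint`,
`TwoModeResonance.exists_solution`). The shift is a priori complex; it is real because V and |F|²
are (`im_eigenvalue_eq_zero`). The equation itself then supplies the decay that makes u a C²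
solution (`isSolution_of_coeff`).

The argument needs the other p_m² to be separated from λ̂⁺, whereas condition (3) separates them
from p_j². If some p_m² is close to λ̂⁺, then p_j² is not (`far_of_isResonantIndex`), which forces
|a| ≤ ε³ (`abs_unitFst_le`). Then ψ_{-1} itself has norm at most ε, and u = 0 with û = -ψ_{-1} meets
every requirement. -/

noncomputable section

/-! ### The convolution algebra ℓ¹(ℤ²). -/

namespace GrossPitaevskii

/-- The space `ℓ¹(ℤ²)` of absolutely summable Fourier coefficients. -/
abbrev Coeff : Type := lp (fun _ : Idx => ℂ) 1

/-- The coefficient sequence with the single entry `c` at `m`. -/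
abbrev mono (m : Idx) (c : ℂ) : Coeff := lp.single 1 m c

namespace Coeff

theorem summable_norm (f : Coeff) : Summable fun m => ‖f m‖ := by
  simpa using (lp.memℓp f).summable (by simp)

theorem norm_eq (f : Coeff) : ‖f‖ = ∑' m, ‖f m‖ := by
  simpa using lp.norm_eq_tsum_rpow (p := 1) (by simp) f

theorem norm_apply_le (f : Coeff) (m : Idx) : ‖f m‖ ≤ ‖f‖ :=
  lp.norm_apply_le_norm one_ne_zero f m

theorem norm_mono (m : Idx) (c : ℂ) : ‖mono m c‖ = ‖c‖ :=
  lp.norm_single (E := fun _ : Idx => ℂ) (p := 1) zero_lt_one m c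

theorem mono_apply (m n : Idx) (c : ℂ) : mono m c n = if n = m then c else 0 := by
  rw [lp.single_apply]
  split_ifs <;> simp_all

theorem add_apply (f g : Coeff) (m : Idx) : (f + g) m = f m + g m := rfl

theorem sub_apply (f g : Coeff) (m : Idx) : (f - g) m = f m - g m := rfl

theorem neg_apply (f : Coeff) (m : Idx) : (-f) m = -f m := rfl

theorem smul_apply (c : ℂ) (f : Coeff) (m : Idx) : (c • f) m = c * f m := rfl

variable {E : Type*} [NormedAddCommGroup E] [NormedSpace ℂ E]

/-- Finite combinations of monomials are dense in ℓ¹. Linear identities for translations, diagonal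
maps and synthesis can therefore be checked on monomials. -/
theorem clm_ext {S T : Coeff →L[ℂ] E} (h : ∀ m, S (mono m 1) = T (mono m 1)) : S = T := by
  refine lp.ext_continuousLinearMap ENNReal.one_ne_top fun m => ?_
  ext
  exact h m

variable [CompleteSpace E]

theorem summable_smul (f : Coeff) {x : Idx → E} {C : ℝ} (hx : ∀ n, ‖x n‖ ≤ C) :
    Summable fun n => f n • x n := by
  refine Summable.of_norm_bounded (f.summable_norm.mul_right C) fun n => ?_
  rw [norm_smul]
  exact mul_le_mul_of_nonneg_left (hx n) (norm_nonneg _)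

/-- The continuous linear map `f ↦ ∑ f_n x_n` attached to a bounded family `x`. -/
def lift (x : Idx → E) (C : ℝ) (hx : ∀ n, ‖x n‖ ≤ C) : Coeff →L[ℂ] E :=
  LinearMap.mkContinuous
    { toFun := fun f => ∑' n, f n • x n
      map_add' := fun f g => by
        rw [← (f.summable_smul hx).tsum_add (g.summable_smul hx)]
        exact tsum_congr fun n => by rw [add_apply, add_smul]
      map_smul' := fun c f => by
        rw [RingHom.id_apply, ← (f.summable_smul hx).tsum_const_smul]
        exact tsum_congr fun n => by rw [smul_apply, mul_smul] }
    C fun f => by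
      rw [norm_eq, mul_comm, ← tsum_mul_right]
      refine tsum_of_norm_bounded (f.summable_norm.mul_right C).hasSum fun n => ?_
      rw [norm_smul]
      exact mul_le_mul_of_nonneg_left (hx n) (norm_nonneg _)

theorem lift_apply (x : Idx → E) (C : ℝ) (hx : ∀ n, ‖x n‖ ≤ C) (f : Coeff) :
    lift x C hx f = ∑' n, f n • x n := rfl

theorem lift_mono (x : Idx → E) (C : ℝ) (hx : ∀ n, ‖x n‖ ≤ C) (m : Idx) (c : ℂ) :
    lift x C hx (mono m c) = c • x m := by
  rw [lift_apply, tsum_eq_single m]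
  · rw [mono_apply, if_pos rfl]
  · intro n hn
    rw [mono_apply, if_neg hn, zero_smul]

theorem norm_lift_le (x : Idx → E) (C : ℝ) (hx : ∀ n, ‖x n‖ ≤ C) : ‖lift x C hx‖ ≤ C :=
  LinearMap.mkContinuous_norm_le _ ((norm_nonneg _).trans (hx 0)) _

/-- Translation of the coefficients by `n`. -/
def shift (n : Idx) : Coeff →L[ℂ] Coeff :=
  lift (fun m => mono (n + m) 1) 1 fun m => by rw [norm_mono, norm_one]

theorem shift_mono (n m : Idx) (c : ℂ) : shift n (mono m c) = mono (n + m) c := by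
  rw [shift, lift_mono, ← lp.single_smul, smul_eq_mul, mul_one]

theorem norm_shift_le (n : Idx) : ‖shift n‖ ≤ 1 := norm_lift_le _ _ _

theorem shift_apply (n : Idx) (f : Coeff) (m : Idx) : shift n f m = f (m - n) := by
  have : (lp.evalCLM ℂ (fun _ : Idx => ℂ) 1 m).comp (shift n)
      = lp.evalCLM ℂ (fun _ : Idx => ℂ) 1 (m - n) := by
    refine clm_ext fun k => ?_
    rw [ContinuousLinearMap.comp_apply, shift_mono]
    change mono (n + k) 1 m = mono k 1 (m - n)
    rw [mono_apply, mono_apply]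
    refine if_congr ?_ rfl rfl
    rw [sub_eq_iff_eq_add, add_comm]
  exact DFunLike.congr_fun this f

/-- Convolution of coefficient sequences, as a bounded bilinear map. -/
def conv : Coeff →L[ℂ] Coeff →L[ℂ] Coeff :=
  lift shift 1 norm_shift_le

theorem norm_conv_le (f g : Coeff) : ‖conv f g‖ ≤ ‖f‖ * ‖g‖ := by
  refine (ContinuousLinearMap.le_opNorm₂ _ f g).trans ?_
  have : ‖conv‖ ≤ 1 := norm_lift_le _ _ _
  nlinarith [mul_nonneg (norm_nonneg f) (norm_nonneg g)]

theorem conv_mono_mono (m n : Idx) (c d : ℂ) :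
    conv (mono m c) (mono n d) = mono (m + n) (c * d) := by
  rw [conv, lift_mono, _root_.smul_apply, shift_mono, ← lp.single_smul, smul_eq_mul]

theorem conv_apply (f g : Coeff) (m : Idx) : conv f g m = ∑' n, f n * g (m - n) := by
  let ev : (Coeff →L[ℂ] Coeff) →L[ℂ] ℂ :=
    (lp.evalCLM ℂ (fun _ : Idx => ℂ) 1 m).comp (ContinuousLinearMap.apply ℂ Coeff g)
  have hs : Summable fun n => f n • shift n := f.summable_smul norm_shift_le
  have h := ev.map_tsum hs
  refine Eq.trans (show conv f g m = ev (∑' n, f n • shift n) from rfl) (h.trans ?_)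
  refine tsum_congr fun n => ?_
  rw [map_smul, smul_eq_mul]
  congr 1
  exact shift_apply n g m

theorem conv_mono_apply (f : Coeff) (n m : Idx) (c : ℂ) :
    conv f (mono n c) m = f (m - n) * c := by
  rw [conv_apply, tsum_eq_single (m - n)]
  · rw [mono_apply, if_pos (by abel)]
  · intro k hk
    rw [mono_apply, if_neg, mul_zero]
    rintro rfl
    exact hk (by abel)

/-- The coefficients of the complex conjugate function. -/
def dag (f : Coeff) : Coeff :=
  ⟨fun m => (starRingEnd ℂ) (f (-m)), memℓp_gen <| by
    simpa [Function.comp_def] using (Equiv.neg Idx).summable_iff.mpr f.summable_norm⟩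

theorem dag_apply (f : Coeff) (m : Idx) : dag f m = (starRingEnd ℂ) (f (-m)) := rfl

theorem dag_add (f g : Coeff) : dag (f + g) = dag f + dag g := by
  ext m
  simp [dag_apply, add_apply]

theorem dag_sub (f g : Coeff) : dag (f - g) = dag f - dag g := by
  ext m
  simp [dag_apply, sub_apply]

theorem norm_dag (f : Coeff) : ‖dag f‖ = ‖f‖ := by
  rw [norm_eq, norm_eq, ← (Equiv.neg Idx).tsum_eq]
  exact tsum_congr fun m => by simp [dag_apply]

theorem dag_mono (m : Idx) (c : ℂ) : dag (mono m c) = mono (-m) ((starRingEnd ℂ) c) := by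
  ext n
  rw [dag_apply, mono_apply, mono_apply]
  by_cases h : n = -m
  · rw [if_pos h, if_pos (by rw [h, neg_neg])]
  · rw [if_neg h, if_neg (fun h' => h (by rw [← h', neg_neg])), map_zero]

/-- The coefficients of `|F|² F`, where `F` has coefficients `f`. -/
def cubic (f : Coeff) : Coeff := conv (conv f f) (dag f)

theorem norm_conv_conv_le (f g h : Coeff) : ‖conv (conv f g) h‖ ≤ ‖f‖ * ‖g‖ * ‖h‖ :=
  (norm_conv_le _ _).trans (mul_le_mul_of_nonneg_right (norm_conv_le _ _) (norm_nonneg _))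

theorem norm_cubic_le (f : Coeff) : ‖cubic f‖ ≤ ‖f‖ ^ 3 := by
  refine (norm_conv_conv_le _ _ _).trans_eq ?_
  rw [norm_dag]
  ring

/-- Telescoping: the three factors of the cubic term are exchanged one at a time. -/
theorem norm_cubic_sub_le {f g : Coeff} {M : ℝ} (hf : ‖f‖ ≤ M) (hg : ‖g‖ ≤ M) :
    ‖cubic f - cubic g‖ ≤ 3 * M ^ 2 * ‖f - g‖ := by
  have hM : 0 ≤ M := (norm_nonneg f).trans hf
  have h : cubic f - cubic g = conv (conv (f - g) f) (dag f) + conv (conv g (f - g)) (dag f)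
      + conv (conv g g) (dag (f - g)) := by
    simp only [cubic, dag_sub, map_sub, _root_.sub_apply]
    abel
  have hd := norm_nonneg (f - g)
  have h1 : ‖conv (conv (f - g) f) (dag f)‖ ≤ ‖f - g‖ * M * M :=
    (norm_conv_conv_le _ _ _).trans (by rw [norm_dag]; gcongr)
  have h2 : ‖conv (conv g (f - g)) (dag f)‖ ≤ M * ‖f - g‖ * M :=
    (norm_conv_conv_le _ _ _).trans (by rw [norm_dag]; gcongr)
  have h3 : ‖conv (conv g g) (dag (f - g))‖ ≤ M * M * ‖f - g‖ :=
    (norm_conv_conv_le _ _ _).trans (by rw [norm_dag]; gcongr)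
  rw [h]
  refine (norm_add₃_le).trans ?_
  nlinarith

end Coeff

/-! ### Plane waves and the synthesis of functions from coefficients. -/

theorem norm_planeWave (ξ x : Plane) : ‖planeWave ξ x‖ = 1 := by
  rw [planeWave, mul_comm]
  exact Complex.norm_exp_ofReal_mul_I _

theorem planeWave_add (ξ η x : Plane) :
    planeWave (ξ + η) x = planeWave ξ x * planeWave η x := by
  simp only [planeWave, inner_add_left, Complex.ofReal_add, mul_add, Complex.exp_add]

theorem planeWave_neg (ξ x : Plane) : planeWave (-ξ) x = (starRingEnd ℂ) (planeWave ξ x) := by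
  simp [planeWave, ← Complex.exp_conj]

theorem planeWave_zero (x : Plane) : planeWave 0 x = 1 := by simp [planeWave]

theorem latticeVec_add (m n : Idx) : latticeVec (m + n) = latticeVec m + latticeVec n := by
  ext s
  simp [latticeVec]

theorem latticeVec_neg (m : Idx) : latticeVec (-m) = -latticeVec m := by
  ext s
  simp [latticeVec]

theorem latticeVec_zero : latticeVec 0 = 0 := by
  ext s
  simp [latticeVec]

/-- The value at `x` of the function with Fourier coefficients `f`, linear in `f`. -/
def synth (x : Plane) : Coeff →L[ℂ] ℂ :=
  Coeff.lift (fun m => planeWave (latticeVec m) x) 1 fun _ => (norm_planeWave _ _).le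

theorem synth_apply (x : Plane) (f : Coeff) :
    synth x f = ∑' m, f m * planeWave (latticeVec m) x := rfl

theorem synth_mono (x : Plane) (m : Idx) (c : ℂ) :
    synth x (mono m c) = c * planeWave (latticeVec m) x := by
  rw [synth, Coeff.lift_mono, smul_eq_mul]

theorem synth_conv (x : Plane) (f g : Coeff) :
    synth x (Coeff.conv f g) = synth x f * synth x g := by
  -- Multiplicativity is extended from monomials one factor at a time: first in the second argument,
  -- then in the first.
  have h : ∀ m, (synth x).comp (Coeff.conv (mono m 1))
      = synth x (mono m 1) • synth x := fun m => by
    refine Coeff.clm_ext fun n => ?_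
    rw [ContinuousLinearMap.comp_apply, Coeff.conv_mono_mono, _root_.smul_apply,
      synth_mono, synth_mono, synth_mono, latticeVec_add, planeWave_add, smul_eq_mul]
    ring
  have h' : (synth x).comp (Coeff.conv.flip g) = synth x g • synth x :=
    Coeff.clm_ext fun m => by
      have := DFunLike.congr_fun (h m) g
      simpa [mul_comm] using this
  simpa [mul_comm] using DFunLike.congr_fun h' f

theorem synth_dag (x : Plane) (f : Coeff) : synth x (Coeff.dag f) = (starRingEnd ℂ) (synth x f) := by
  rw [synth_apply, synth_apply, Complex.conj_tsum, ← (Equiv.neg Idx).tsum_eq]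
  refine tsum_congr fun m => ?_
  simp [Coeff.dag_apply, latticeVec_neg, planeWave_neg]

theorem synth_cubic (x : Plane) (f : Coeff) :
    synth x (Coeff.cubic f) = (‖synth x f‖ : ℂ) ^ 2 * synth x f := by
  rw [Coeff.cubic, synth_conv, synth_conv, synth_dag, ← Complex.mul_conj']
  ring

/-! ### Orthogonality on the period cell and recovery of the Fourier coefficients. -/

theorem integral_exp_int_mul (n : ℤ) :
    ∫ y in Set.Icc (0 : ℝ) (2 * Real.pi), Complex.exp (Complex.I * n * y)
      = if n = 0 then (2 * Real.pi : ℂ) else 0 := by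
  rw [integral_Icc_eq_integral_Ioc, ← intervalIntegral.integral_of_le (by positivity)]
  split_ifs with hn
  · simp [hn]
  · rw [integral_exp_mul_complex (by simp [hn])]
    have : Complex.exp (Complex.I * n * ((2 * Real.pi : ℝ) : ℂ)) = 1 := by
      rw [Complex.exp_eq_one_iff]
      exact ⟨n, by push_cast; ring⟩
    rw [this]
    simp

theorem periodCell_eq_preimage :
    periodCell = (WithLp.ofLp : Plane → Fin 2 → ℝ) ⁻¹'
      Set.univ.pi fun _ => Set.Icc (0 : ℝ) (2 * Real.pi) := by
  ext x
  simp only [periodCell, Set.mem_ofPred_eq, Set.mem_preimage, Set.mem_univ_pi]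

theorem volume_periodCell : volume periodCell = ENNReal.ofReal (2 * Real.pi) ^ 2 := by
  rw [periodCell_eq_preimage, (PiLp.volume_preserving_ofLp (Fin 2)).measure_preimage
    (MeasurableSet.univ_pi fun _ => measurableSet_Icc).nullMeasurableSet, volume_pi_pi]
  simp [sq]

theorem planeWave_latticeVec (m : Idx) (x : Plane) :
    planeWave (latticeVec m) x = ∏ s, Complex.exp (Complex.I * m s * x s) := by
  rw [planeWave, ← Complex.exp_sum]
  congr 1
  simp [latticeVec, PiLp.inner_apply, Fin.sum_univ_two]
  ring

theorem integral_periodCell_planeWave (m : Idx) :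
    ∫ x in periodCell, planeWave (latticeVec m) x
      = if m = 0 then ((2 * Real.pi) ^ 2 : ℂ) else 0 := by
  have he : MeasurableEmbedding (WithLp.ofLp : Plane → Fin 2 → ℝ) :=
    (MeasurableEquiv.toLp 2 (Fin 2 → ℝ)).symm.measurableEmbedding
  simp_rw [planeWave_latticeVec]
  rw [periodCell_eq_preimage]
  rw [(PiLp.volume_preserving_ofLp (Fin 2)).setIntegral_preimage_emb he
    (fun y => ∏ s, Complex.exp (Complex.I * m s * y s)), volume_pi, Measure.restrict_pi_pi,
    integral_fintype_prod_eq_prod (fun s (y : ℝ) => Complex.exp (Complex.I * m s * y))]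
  simp_rw [integral_exp_int_mul]
  rw [Fin.prod_univ_two]
  have : m = 0 ↔ m 0 = 0 ∧ m 1 = 0 := by
    rw [funext_iff, Fin.forall_fin_two]
    rfl
  by_cases h0 : m 0 = 0 <;> by_cases h1 : m 1 = 0 <;> simp [this, h0, h1, sq]

theorem continuous_planeWave (ξ : Plane) : Continuous (planeWave ξ) := by
  unfold planeWave
  fun_prop

theorem continuous_synth (f : Coeff) : Continuous fun x => synth x f := by
  simp_rw [synth_apply]
  refine continuous_tsum (fun m => (continuous_planeWave _).const_mul _) f.summable_norm
    fun m x => ?_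
  rw [norm_mul, norm_planeWave, mul_one]

theorem planeWave_add_period (ξ x : Plane) (s : Fin 2) :
    planeWave ξ (x + period s) = Complex.exp (2 * Real.pi * Complex.I * (ξ s : ℂ))
      * planeWave ξ x := by
  rw [planeWave, planeWave, ← Complex.exp_add]
  congr 1
  rw [inner_add_right, period, EuclideanSpace.inner_single_right]
  simp
  ring

theorem exp_two_pi_mul_int (n : ℤ) :
    Complex.exp (2 * Real.pi * Complex.I * (((n : ℝ) : ℝ) : ℂ)) = 1 := by
  rw [Complex.exp_eq_one_iff]
  exact ⟨n, by push_cast; ring⟩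

theorem isPeriodic_synth (f : Coeff) : IsPeriodic fun x => synth x f := by
  intro x s
  simp_rw [synth_apply]
  refine tsum_congr fun m => ?_
  rw [planeWave_add_period]
  change f m * (Complex.exp (2 * Real.pi * Complex.I * (((m s : ℤ) : ℝ) : ℂ)) * _) = _
  rw [exp_two_pi_mul_int, one_mul]

/-- Absolute summability allows termwise integration over the cell, and orthogonality leaves one
term. This identifies ‖·‖_* with the ℓ¹ norm and makes synthesis injective. -/
theorem fourierCoef_synth (f : Coeff) (m : Idx) : fourierCoef (fun x => synth x f) m = f m := by
  have hfin : volume periodCell ≠ ∞ := by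
    rw [volume_periodCell]
    exact ENNReal.pow_ne_top ENNReal.ofReal_ne_top
  have : IsFiniteMeasure (volume.restrict periodCell) := ⟨by simpa using hfin.lt_top⟩
  let F : Idx → Plane → ℂ := fun n x => f n * planeWave (latticeVec (n - m)) x
  have hnorm : ∀ n x, ‖F n x‖ = ‖f n‖ := fun n x => by
    rw [norm_mul, norm_planeWave, mul_one]
  have hint : ∀ n, Integrable (F n) (volume.restrict periodCell) := fun n =>
    Integrable.of_bound ((continuous_planeWave _).const_mul _).aestronglyMeasurable ‖f n‖
      (Filter.Eventually.of_forall fun x => (hnorm n x).le)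
  have hsum : Summable fun n => ∫ x in periodCell, ‖F n x‖ := by
    simp_rw [hnorm, integral_const, smul_eq_mul]
    exact f.summable_norm.mul_left _
  have hF : ∀ x, synth x f * planeWave (-latticeVec m) x = ∑' n, F n x := fun x => by
    rw [synth_apply, ← tsum_mul_right]
    refine tsum_congr fun n => ?_
    rw [mul_assoc, ← planeWave_add, ← latticeVec_neg, ← latticeVec_add, ← sub_eq_add_neg]
  rw [fourierCoef]
  simp_rw [hF]
  rw [← integral_tsum_of_summable_integral_norm hint hsum, tsum_eq_single m]
  · simp_rw [F, integral_const_mul, integral_periodCell_planeWave]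
    rw [if_pos (sub_self m)]
    have : (Real.pi : ℂ) ≠ 0 := by exact_mod_cast Real.pi_ne_zero
    field_simp
  · intro n hn
    simp_rw [F, integral_const_mul, integral_periodCell_planeWave]
    rw [if_neg (sub_ne_zero.mpr hn), mul_zero]

theorem starNorm_synth (f : Coeff) : starNorm (fun x => synth x f) = ENNReal.ofReal ‖f‖ := by
  rw [starNorm, Coeff.norm_eq, ENNReal.ofReal_tsum_of_nonneg (fun _ => norm_nonneg _)
    f.summable_norm]
  exact tsum_congr fun m => by rw [fourierCoef_synth, ofReal_norm]

theorem synth_injective {f g : Coeff} (h : ∀ x, synth x f = synth x g) : f = g := by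
  ext m
  rw [← fourierCoef_synth f, ← fourierCoef_synth g]
  simp_rw [h]

/-- A finitely supported coefficient family as an element of `ℓ¹`. -/
def Coeff.ofFinsupp (v : Idx →₀ ℂ) : Coeff :=
  ⟨fun m => v m, memℓp_gen <| by
    refine summable_of_ne_finset_zero (s := v.support) fun m hm => ?_
    rw [Finsupp.notMem_support_iff.mp hm]
    simp⟩

theorem Coeff.ofFinsupp_apply (v : Idx →₀ ℂ) (m : Idx) : Coeff.ofFinsupp v m = v m := rfl

theorem synth_ofFinsupp (v : Idx →₀ ℂ) (x : Plane) :
    synth x (Coeff.ofFinsupp v) = trigPoly v x := by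
  rw [synth_apply, trigPoly, Finsupp.sum, tsum_eq_sum (s := v.support)]
  · rfl
  · intro m hm
    rw [Coeff.ofFinsupp_apply, Finsupp.notMem_support_iff.mp hm, zero_mul]

theorem starNorm_trigPoly (v : Idx →₀ ℂ) :
    starNorm (trigPoly v) = ENNReal.ofReal ‖Coeff.ofFinsupp v‖ := by
  rw [← starNorm_synth]
  congr 1
  exact funext fun x => (synth_ofFinsupp v x).symm

/-! ### Differentiation of plane wave series. -/

theorem planeWave_eq_comp (ξ : Plane) :
    planeWave ξ = (fun r : ℝ => Complex.exp (r * Complex.I)) ∘ innerSL ℝ ξ := by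
  ext x
  simp [planeWave, mul_comm]

theorem contDiff_exp_ofReal_mul_I {n : WithTop ℕ∞} :
    ContDiff ℝ n fun r : ℝ => Complex.exp (r * Complex.I) :=
  (Complex.ofRealCLM.contDiff.mul contDiff_const).cexp

theorem contDiff_planeWave {n : WithTop ℕ∞} (ξ : Plane) : ContDiff ℝ n (planeWave ξ) := by
  rw [planeWave_eq_comp]
  exact contDiff_exp_ofReal_mul_I.comp (innerSL ℝ ξ).contDiff

theorem iteratedDeriv_exp_ofReal_mul_I (n : ℕ) :
    iteratedDeriv n (fun r : ℝ => Complex.exp (r * Complex.I))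
      = fun r : ℝ => Complex.I ^ n * Complex.exp (r * Complex.I) := by
  induction n with
  | zero => simp
  | succ n ih =>
    rw [iteratedDeriv_succ, ih]
    ext r
    have h : HasDerivAt (fun r : ℝ => Complex.exp (r * Complex.I))
        (Complex.exp (r * Complex.I) * (1 * Complex.I)) r :=
      ((Complex.ofRealCLM.hasDerivAt (x := r)).mul_const Complex.I).cexp
    rw [(h.const_mul (Complex.I ^ n)).deriv]
    ring

theorem iteratedFDeriv_planeWave_apply (ξ x : Plane) (n : ℕ) (y : Fin n → Plane) :
    iteratedFDeriv ℝ n (planeWave ξ) x y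
      = (∏ i, (inner ℝ ξ (y i) : ℂ)) * (Complex.I ^ n * planeWave ξ x) := by
  conv_lhs => rw [planeWave_eq_comp]
  rw [(innerSL ℝ ξ).iteratedFDeriv_comp_right (contDiff_exp_ofReal_mul_I (n := n)) x le_rfl,
    ContinuousMultilinearMap.compContinuousLinearMap_apply,
    iteratedFDeriv_apply_eq_iteratedDeriv_mul_prod,
    iteratedDeriv_exp_ofReal_mul_I]
  simp [planeWave, mul_comm]

theorem norm_iteratedFDeriv_planeWave_le (ξ x : Plane) (n : ℕ) :
    ‖iteratedFDeriv ℝ n (planeWave ξ) x‖ ≤ ‖ξ‖ ^ n := by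
  refine ContinuousMultilinearMap.opNorm_le_bound (by positivity) fun y => ?_
  rw [iteratedFDeriv_planeWave_apply, norm_mul, norm_mul, norm_pow, Complex.norm_I, one_pow,
    norm_planeWave, one_mul, mul_one, norm_prod]
  calc ∏ i, ‖((inner ℝ ξ (y i) : ℝ) : ℂ)‖ ≤ ∏ i, ‖ξ‖ * ‖y i‖ :=
        Finset.prod_le_prod (fun _ _ => norm_nonneg _) fun i _ => by
          rw [Complex.norm_real]
          exact norm_inner_le_norm _ _
    _ = ‖ξ‖ ^ n * ∏ i, ‖y i‖ := by simp [Finset.prod_mul_distrib]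

theorem laplacian_planeWave_term (c : ℂ) (ξ x : Plane) :
    ∑ s : Fin 2, iteratedFDeriv ℝ 2 (fun y => c * planeWave ξ y) x
      ![EuclideanSpace.basisFun (Fin 2) ℝ s, EuclideanSpace.basisFun (Fin 2) ℝ s]
      = -((‖ξ‖ ^ 2 : ℝ) * c * planeWave ξ x) := by
  have h : (fun y => c * planeWave ξ y) = c • planeWave ξ := rfl
  rw [h, iteratedFDeriv_const_smul_apply (contDiff_planeWave ξ).contDiffAt,
    EuclideanSpace.real_norm_sq_eq]
  simp only [_root_.smul_apply, iteratedFDeriv_planeWave_apply]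
  simp [EuclideanSpace.inner_single_right]
  ring

section Series

variable {ι : Type*} {c : ι → ℂ} {ξ : ι → Plane}

theorem summable_norm_mul_pow_of_le_two (h0 : Summable fun i => ‖c i‖)
    (h2 : Summable fun i => ‖c i‖ * ‖ξ i‖ ^ 2) (n : ℕ) (hn : (n : ℕ∞) ≤ 2) :
    Summable fun i => ‖c i‖ * ‖ξ i‖ ^ n := by
  refine Summable.of_nonneg_of_le (fun i => by positivity) (fun i => ?_) (h0.add h2)
  rw [← mul_one_add]
  refine mul_le_mul_of_nonneg_left ?_ (norm_nonneg _)
  have hn' : n ≤ 2 := by exact_mod_cast hn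
  interval_cases n <;> nlinarith [sq_nonneg (‖ξ i‖ - 1)]

theorem norm_iteratedFDeriv_const_mul_planeWave_le (c : ℂ) (ξ x : Plane) (n : ℕ) :
    ‖iteratedFDeriv ℝ n (fun y => c * planeWave ξ y) x‖ ≤ ‖c‖ * ‖ξ‖ ^ n := by
  have h : (fun y => c * planeWave ξ y) = c • planeWave ξ := rfl
  rw [h, iteratedFDeriv_const_smul_apply (contDiff_planeWave ξ).contDiffAt, norm_smul]
  exact mul_le_mul_of_nonneg_left (norm_iteratedFDeriv_planeWave_le _ _ _) (norm_nonneg _)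

theorem contDiff_tsum_planeWave (h0 : Summable fun i => ‖c i‖)
    (h2 : Summable fun i => ‖c i‖ * ‖ξ i‖ ^ 2) :
    ContDiff ℝ 2 fun x => ∑' i, c i * planeWave (ξ i) x :=
  contDiff_tsum (N := 2) (v := fun n i => ‖c i‖ * ‖ξ i‖ ^ n)
    (fun _ => contDiff_const.mul (contDiff_planeWave _))
    (summable_norm_mul_pow_of_le_two h0 h2)
    fun _ _ _ _ => norm_iteratedFDeriv_const_mul_planeWave_le _ _ _ _

theorem laplacian_tsum_planeWave (h0 : Summable fun i => ‖c i‖)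
    (h2 : Summable fun i => ‖c i‖ * ‖ξ i‖ ^ 2) (x : Plane) :
    Laplacian.laplacian (fun x => ∑' i, c i * planeWave (ξ i) x) x
      = -∑' i, (‖ξ i‖ ^ 2 : ℝ) * c i * planeWave (ξ i) x := by
  have hs : Summable fun i => iteratedFDeriv ℝ 2 (fun y => c i * planeWave (ξ i) y) x :=
    Summable.of_norm_bounded h2 fun _ => norm_iteratedFDeriv_const_mul_planeWave_le _ _ _ _
  rw [InnerProductSpace.laplacian_eq_iteratedFDeriv_orthonormalBasis _
    (EuclideanSpace.basisFun (Fin 2) ℝ)]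
  dsimp only
  rw [iteratedFDeriv_tsum_apply (N := 2) (v := fun n i => ‖c i‖ * ‖ξ i‖ ^ n)
    (fun _ => contDiff_const.mul (contDiff_planeWave _))
    (summable_norm_mul_pow_of_le_two h0 h2)
    (fun _ _ _ _ => norm_iteratedFDeriv_const_mul_planeWave_le _ _ _ _) le_rfl]
  have happ : ∀ y : Fin 2 → Plane,
      HasSum (fun i => iteratedFDeriv ℝ 2 (fun y => c i * planeWave (ξ i) y) x y)
        ((∑' i, iteratedFDeriv ℝ 2 (fun y => c i * planeWave (ξ i) y) x) y) := fun y =>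
    hs.hasSum.mapL (ContinuousMultilinearMap.apply ℝ (fun _ : Fin 2 => Plane) ℂ y)
  have h := hasSum_sum (s := Finset.univ) fun (s : Fin 2) _ =>
    happ ![EuclideanSpace.basisFun (Fin 2) ℝ s, EuclideanSpace.basisFun (Fin 2) ℝ s]
  rw [← h.tsum_eq, ← tsum_neg]
  exact tsum_congr fun i => laplacian_planeWave_term _ _ _

end Series

/-! ### Two-mode sequences on the block {0, -q}. -/

namespace Coeff

/-- The coefficient sequence with entries `c` at `0` and `d` at `-q`. -/
def twoMode (q : Idx) (c d : ℂ) : Coeff := mono 0 c + mono (-q) d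

theorem norm_twoMode_le (q : Idx) (c d : ℂ) : ‖twoMode q c d‖ ≤ ‖c‖ + ‖d‖ := by
  refine (norm_add_le _ _).trans_eq ?_
  rw [norm_mono, norm_mono]

theorem twoMode_apply_zero {q : Idx} (hq : q ≠ 0) (c d : ℂ) : twoMode q c d 0 = c := by
  rw [twoMode, add_apply, mono_apply, mono_apply, if_pos rfl, if_neg, add_zero]
  exact fun h => hq (neg_eq_zero.mp h.symm)

theorem twoMode_apply_neg {q : Idx} (hq : q ≠ 0) (c d : ℂ) : twoMode q c d (-q) = d := by
  rw [twoMode, add_apply, mono_apply, mono_apply, if_pos rfl, if_neg, zero_add]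
  exact fun h => hq (neg_eq_zero.mp h)

theorem twoMode_apply_of_ne {q m : Idx} (h0 : m ≠ 0) (h1 : m ≠ -q) (c d : ℂ) :
    twoMode q c d m = 0 := by
  rw [twoMode, add_apply, mono_apply, mono_apply, if_neg h0, if_neg h1, add_zero]

theorem smul_twoMode (q : Idx) (r c d : ℂ) : r • twoMode q c d = twoMode q (r * c) (r * d) := by
  rw [twoMode, twoMode, smul_add, ← lp.single_smul, ← lp.single_smul, smul_eq_mul, smul_eq_mul]

theorem conv_twoMode_apply (v : Coeff) (q : Idx) (c d : ℂ) (m : Idx) :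
    conv v (twoMode q c d) m = v m * c + v (m + q) * d := by
  rw [twoMode, map_add, add_apply, conv_mono_apply, conv_mono_apply, sub_zero, sub_neg_eq_add]

/-- The functional `x ↦ c x_0 + d x_{-q}`. -/
def pair (q : Idx) (c d : ℂ) : Coeff →L[ℂ] ℂ :=
  c • lp.evalCLM ℂ (fun _ : Idx => ℂ) 1 0 + d • lp.evalCLM ℂ (fun _ : Idx => ℂ) 1 (-q)

theorem pair_apply (q : Idx) (c d : ℂ) (x : Coeff) : pair q c d x = c * x 0 + d * x (-q) := rfl

theorem norm_apply_zero_add_le {q : Idx} (hq : q ≠ 0) (x : Coeff) : ‖x 0‖ + ‖x (-q)‖ ≤ ‖x‖ := by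
  rw [norm_eq, ← Finset.sum_pair (f := fun m => ‖x m‖) (neg_ne_zero.mpr hq).symm]
  exact x.summable_norm.sum_le_tsum _ fun _ _ => norm_nonneg _

theorem norm_pair_le {q : Idx} (hq : q ≠ 0) {c d : ℂ} (hc : ‖c‖ ≤ 1) (hd : ‖d‖ ≤ 1) (x : Coeff) :
    ‖pair q c d x‖ ≤ ‖x‖ := by
  refine le_trans ?_ (norm_apply_zero_add_le hq x)
  rw [pair_apply]
  refine (norm_add_le _ _).trans ?_
  rw [norm_mul, norm_mul]
  exact add_le_add (mul_le_of_le_one_left (norm_nonneg _) hc)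
    (mul_le_of_le_one_left (norm_nonneg _) hd)

/-- Multiplication of the coefficients by a bounded sequence. -/
def diag (r : Idx → ℂ) (K : ℝ) (hr : ∀ m, ‖r m‖ ≤ K) : Coeff →L[ℂ] Coeff :=
  lift (fun m => mono m (r m)) K fun m => (norm_mono m (r m)).trans_le (hr m)

theorem norm_diag_le (r : Idx → ℂ) (K : ℝ) (hr : ∀ m, ‖r m‖ ≤ K) (x : Coeff) :
    ‖diag r K hr x‖ ≤ K * ‖x‖ :=
  (diag r K hr).le_of_opNorm_le (norm_lift_le _ _ _) x

theorem diag_apply (r : Idx → ℂ) (K : ℝ) (hr : ∀ m, ‖r m‖ ≤ K) (x : Coeff) (m : Idx) :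
    diag r K hr x m = r m * x m := by
  have : (lp.evalCLM ℂ (fun _ : Idx => ℂ) 1 m).comp (diag r K hr)
      = r m • lp.evalCLM ℂ (fun _ : Idx => ℂ) 1 m := by
    refine clm_ext fun n => ?_
    rw [ContinuousLinearMap.comp_apply, diag, lift_mono, one_smul]
    change mono n (r n) m = r m * mono n 1 m
    rw [mono_apply, mono_apply]
    split_ifs with h
    · rw [h, mul_one]
    · rw [mul_zero]
  exact DFunLike.congr_fun this x

theorem cubic_twoMode {q : Idx} (a b : ℂ) :
    cubic (twoMode q a b)
      = mono 0 ((a * (starRingEnd ℂ) a + 2 * (b * (starRingEnd ℂ) b)) * a)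
        + mono (-q) ((b * (starRingEnd ℂ) b + 2 * (a * (starRingEnd ℂ) a)) * b)
        + mono q (a * a * (starRingEnd ℂ) b) + mono (-q + -q) (b * b * (starRingEnd ℂ) a) := by
  have hz : (a * (starRingEnd ℂ) a + 2 * (b * (starRingEnd ℂ) b)) * a
      = a * a * (starRingEnd ℂ) a + b * a * (starRingEnd ℂ) b + a * b * (starRingEnd ℂ) b := by ring
  have hn : (b * (starRingEnd ℂ) b + 2 * (a * (starRingEnd ℂ) a)) * b
      = b * b * (starRingEnd ℂ) b + b * a * (starRingEnd ℂ) a + a * b * (starRingEnd ℂ) a := by ring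
  rw [hz, hn]
  simp only [cubic, twoMode, dag_add, dag_mono, map_add, _root_.add_apply, conv_mono_mono,
    neg_zero, neg_neg, add_zero, zero_add, neg_add_cancel, neg_add_cancel_right, lp.single_add]
  abel

theorem cubic_twoMode_apply_zero {q : Idx} (hq : q ≠ 0) (a b : ℂ) :
    cubic (twoMode q a b) 0
      = (a * (starRingEnd ℂ) a + 2 * (b * (starRingEnd ℂ) b)) * a := by
  have h2 : (0 : Idx) ≠ -q + -q := fun h => hq (by
    rw [← neg_add, eq_comm, neg_eq_zero] at h
    exact self_eq_neg.mp (eq_neg_of_add_eq_zero_left h))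
  rw [cubic_twoMode]
  simp only [add_apply, mono_apply]
  rw [if_true, if_neg (neg_ne_zero.mpr hq).symm, if_neg hq.symm, if_neg h2, add_zero, add_zero,
    add_zero]

theorem cubic_twoMode_apply_neg {q : Idx} (hq : q ≠ 0) (a b : ℂ) :
    cubic (twoMode q a b) (-q)
      = (b * (starRingEnd ℂ) b + 2 * (a * (starRingEnd ℂ) a)) * b := by
  have h2 : -q ≠ -q + -q := fun h => hq (neg_eq_zero.mp (left_eq_add.mp h))
  have h3 : -q ≠ q := fun h => hq (neg_eq_self.mp h)
  rw [cubic_twoMode]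
  simp only [add_apply, mono_apply]
  rw [if_true, if_neg (neg_ne_zero.mpr hq), if_neg h3, if_neg h2, add_zero, add_zero,
    zero_add]

/-- The functional is the inner product with (-b̄, ā), and on the cubic term it collapses to ab(|a|²
- |b|²). The crude bound ‖a‖ + ‖b‖ ≤ 3/2 cubed would be too large for the initial step of the
contraction. -/
theorem norm_pair_cubic_twoMode_le {q : Idx} (hq : q ≠ 0) {a b : ℂ}
    (hab : ‖a‖ ^ 2 + ‖b‖ ^ 2 = 1) : ‖pair q (-b) a (cubic (twoMode q a b))‖ ≤ 1 / 2 := by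
  have h : pair q (-b) a (cubic (twoMode q a b))
      = a * b * ((‖a‖ ^ 2 - ‖b‖ ^ 2 : ℝ) : ℂ) := by
    rw [pair_apply, cubic_twoMode_apply_zero hq, cubic_twoMode_apply_neg hq, Complex.mul_conj',
      Complex.mul_conj']
    push_cast
    ring
  rw [h, norm_mul, norm_mul, Complex.norm_real, Real.norm_eq_abs]
  have h1 : ‖a‖ * ‖b‖ ≤ 1 / 2 := by nlinarith [sq_nonneg (‖a‖ - ‖b‖)]
  have h2 : |‖a‖ ^ 2 - ‖b‖ ^ 2| ≤ 1 := by
    rw [abs_le]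
    constructor <;> nlinarith [sq_nonneg ‖a‖, sq_nonneg ‖b‖]
  calc ‖a‖ * ‖b‖ * |‖a‖ ^ 2 - ‖b‖ ^ 2| ≤ 1 / 2 * 1 := by gcongr
    _ = 1 / 2 := mul_one _

end Coeff

/-! ### The Lyapunov–Schmidt contraction. -/

open Coeff

/-- The data of a two-mode resonance: `(a, b)` is a unit eigenvector of the block
`((p_0, v_q), (v_{-q}, p_{-q}))` for the eigenvalue `lam₀`, its orthogonal complement is spanned by
an eigenvector for `lam₀ - g`, and the other free eigenvalues stay away from `lam₀`. -/
structure TwoModeResonance (ε σ g lam₀ : ℝ) (q : Idx) (p : Idx → ℝ) (v : Coeff) (a b : ℂ) :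
    Prop where
  eps_pos : 0 < ε
  eps_le : ε ≤ 1 / 1000
  q_ne : q ≠ 0
  norm_v : ‖v‖ ≤ ε ^ 9
  v_zero : v 0 = 0
  unit : ‖a‖ ^ 2 + ‖b‖ ^ 2 = 1
  row_zero : ((p 0 - lam₀ : ℝ) : ℂ) * a + v q * b = 0
  row_neg : v (-q) * a + ((p (-q) - lam₀ : ℝ) : ℂ) * b = 0
  row_zero_orth : ((p 0 - lam₀ : ℝ) : ℂ) * -(starRingEnd ℂ) b + v q * (starRingEnd ℂ) a
    = g * (starRingEnd ℂ) b
  row_neg_orth : v (-q) * -(starRingEnd ℂ) b + ((p (-q) - lam₀ : ℝ) : ℂ) * (starRingEnd ℂ) a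
    = -(g * (starRingEnd ℂ) a)
  gap : 2 * ε ^ 10 ≤ g
  sep : ∀ m, m ≠ 0 → m ≠ -q → ε ^ 6 ≤ 2 * |p m - lam₀|
  coupling : |σ| ≤ ε ^ 11

/-- The reciprocals of `p_m - lam₀` off the block `{0, -q}`. -/
def blockInv (q : Idx) (p : Idx → ℝ) (lam₀ : ℝ) (m : Idx) : ℂ :=
  if m = 0 ∨ m = -q then 0 else ((p m - lam₀ : ℝ) : ℂ)⁻¹

namespace TwoModeResonance

variable {ε σ g lam₀ : ℝ} {q : Idx} {p : Idx → ℝ} {v : Coeff} {a b : ℂ}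

theorem norm_blockInv_le (h : TwoModeResonance ε σ g lam₀ q p v a b) (m : Idx) :
    ‖blockInv q p lam₀ m‖ ≤ 2 / ε ^ 6 := by
  have hε := h.eps_pos
  rw [blockInv]
  split_ifs with hm
  · rw [norm_zero]
    positivity
  · push Not at hm
    have := h.sep m hm.1 hm.2
    rw [norm_inv, Complex.norm_real, Real.norm_eq_abs, le_div_iff₀ (by positivity),
      inv_mul_le_iff₀ (by nlinarith [pow_pos hε 6])]
    linarith

theorem norm_a_le (h : TwoModeResonance ε σ g lam₀ q p v a b) : ‖a‖ ≤ 1 := by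
  nlinarith [h.unit, sq_nonneg ‖b‖, norm_nonneg a]

theorem norm_b_le (h : TwoModeResonance ε σ g lam₀ q p v a b) : ‖b‖ ≤ 1 := by
  nlinarith [h.unit, sq_nonneg ‖a‖, norm_nonneg b]

theorem norm_a_add_norm_b_le (h : TwoModeResonance ε σ g lam₀ q p v a b) :
    ‖a‖ + ‖b‖ ≤ 3 / 2 := by
  nlinarith [h.unit, sq_nonneg (‖a‖ - ‖b‖), norm_nonneg a, norm_nonneg b]

theorem gap_pos (h : TwoModeResonance ε σ g lam₀ q p v a b) : 0 < g :=
  lt_of_lt_of_le (by have := h.eps_pos; positivity) h.gap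

/-- The part of the ansatz orthogonal to `(a, b)`, with its component off the block
scaled by `16ε²`. -/
def correction (ε : ℝ) (q : Idx) (a b : ℂ) (y : ℂ × Coeff) : Coeff :=
  y.1 • twoMode q (-(starRingEnd ℂ) b) ((starRingEnd ℂ) a) + ((16 * ε ^ 2 : ℝ) : ℂ) • y.2

/-- The ansatz for the nonlinear eigenvector. -/
def ansatz (ε : ℝ) (q : Idx) (a b : ℂ) (y : ℂ × Coeff) : Coeff :=
  twoMode q a b + correction ε q a b y

/-- The perturbation acting on the block. -/
def source (ε σ : ℝ) (q : Idx) (v : Coeff) (a b : ℂ) (y : ℂ × Coeff) : Coeff :=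
  ((16 * ε ^ 2 : ℝ) : ℂ) • conv v y.2 + (σ : ℂ) • cubic (ansatz ε q a b y)

/-- The shift of the eigenvalue. -/
def eigShift (ε σ : ℝ) (q : Idx) (v : Coeff) (a b : ℂ) (y : ℂ × Coeff) : ℂ :=
  pair q ((starRingEnd ℂ) a) ((starRingEnd ℂ) b) (source ε σ q v a b y)

/-- The perturbation acting off the block. -/
def offSource (ε σ : ℝ) (q : Idx) (v : Coeff) (a b : ℂ) (y : ℂ × Coeff) : Coeff :=
  conv v (ansatz ε q a b y) + (σ : ℂ) • cubic (ansatz ε q a b y)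
    - eigShift ε σ q v a b y • ((16 * ε ^ 2 : ℝ) : ℂ) • y.2

/-- The map whose fixed points are the nonlinear eigenvectors. -/
def iteration (h : TwoModeResonance ε σ g lam₀ q p v a b) (y : ℂ × Coeff) : ℂ × Coeff :=
  ((g : ℂ)⁻¹ * (pair q (-b) a (source ε σ q v a b y) - eigShift ε σ q v a b y * y.1),
    -(((16 * ε ^ 2 : ℝ) : ℂ)⁻¹ •
      diag (blockInv q p lam₀) (2 / ε ^ 6) h.norm_blockInv_le (offSource ε σ q v a b y)))

theorem norm_correction_sub_le (h : TwoModeResonance ε σ g lam₀ q p v a b) (y y' : ℂ × Coeff) :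
    ‖correction ε q a b y - correction ε q a b y'‖
      ≤ 3 / 2 * ‖y.1 - y'.1‖ + 16 * ε ^ 2 * ‖y.2 - y'.2‖ := by
  have h1 : correction ε q a b y - correction ε q a b y'
      = (y.1 - y'.1) • twoMode q (-(starRingEnd ℂ) b) ((starRingEnd ℂ) a)
        + ((16 * ε ^ 2 : ℝ) : ℂ) • (y.2 - y'.2) := by
    rw [correction, correction, sub_smul, smul_sub]
    abel
  have h2 : ‖twoMode q (-(starRingEnd ℂ) b) ((starRingEnd ℂ) a)‖ ≤ 3 / 2 := by
    refine (norm_twoMode_le _ _ _).trans ?_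
    rw [norm_neg, RCLike.norm_conj, RCLike.norm_conj, add_comm]
    exact h.norm_a_add_norm_b_le
  rw [h1]
  refine (norm_add_le _ _).trans ?_
  rw [norm_smul, norm_smul, Complex.norm_real, Real.norm_of_nonneg (by positivity)]
  nlinarith [norm_nonneg (y.1 - y'.1)]

theorem norm_correction_sub_le_two_mul (h : TwoModeResonance ε σ g lam₀ q p v a b)
    (y y' : ℂ × Coeff) :
    ‖correction ε q a b y - correction ε q a b y'‖ ≤ 2 * ‖y - y'‖ := by
  refine (h.norm_correction_sub_le y y').trans ?_
  have h1 : ‖y.1 - y'.1‖ ≤ ‖y - y'‖ := norm_fst_le (y - y')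
  have h2 : ‖y.2 - y'.2‖ ≤ ‖y - y'‖ := norm_snd_le (y - y')
  have h3 : 16 * ε ^ 2 ≤ 1 / 2 := by nlinarith [h.eps_pos, h.eps_le]
  nlinarith [norm_nonneg (y.2 - y'.2)]

theorem norm_correction_le (h : TwoModeResonance ε σ g lam₀ q p v a b) {y : ℂ × Coeff}
    (hy : ‖y‖ ≤ ε / 2) : ‖correction ε q a b y‖ ≤ ε := by
  have h1 := h.norm_correction_sub_le_two_mul y 0
  have h0 : correction ε q a b 0 = 0 := by simp [correction]
  rw [h0, sub_zero, sub_zero] at h1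
  linarith

theorem norm_ansatz_le (h : TwoModeResonance ε σ g lam₀ q p v a b) {y : ℂ × Coeff}
    (hy : ‖y‖ ≤ ε / 2) : ‖ansatz ε q a b y‖ ≤ 2 := by
  have h1 := h.norm_correction_le hy
  have h2 := (norm_twoMode_le q a b).trans h.norm_a_add_norm_b_le
  have h3 := norm_add_le (twoMode q a b) (correction ε q a b y)
  have h4 := h.eps_le
  rw [ansatz]
  linarith

theorem norm_ansatz_sub_le (h : TwoModeResonance ε σ g lam₀ q p v a b) (y y' : ℂ × Coeff) :
    ‖ansatz ε q a b y - ansatz ε q a b y'‖ ≤ 2 * ‖y - y'‖ := by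
  rw [ansatz, ansatz, add_sub_add_left_eq_sub]
  exact h.norm_correction_sub_le_two_mul y y'

theorem norm_cubic_ansatz_sub_le (h : TwoModeResonance ε σ g lam₀ q p v a b) {y y' : ℂ × Coeff}
    (hy : ‖y‖ ≤ ε / 2) (hy' : ‖y'‖ ≤ ε / 2) :
    ‖(σ : ℂ) • cubic (ansatz ε q a b y) - (σ : ℂ) • cubic (ansatz ε q a b y')‖
      ≤ 24 * ε ^ 11 * ‖y - y'‖ := by
  rw [← smul_sub, norm_smul, Complex.norm_real, Real.norm_eq_abs]
  have h1 := norm_cubic_sub_le (h.norm_ansatz_le hy) (h.norm_ansatz_le hy')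
  have h2 := h.norm_ansatz_sub_le y y'
  calc |σ| * ‖cubic (ansatz ε q a b y) - cubic (ansatz ε q a b y')‖
      ≤ ε ^ 11 * (24 * ‖y - y'‖) :=
        mul_le_mul h.coupling (by linarith) (norm_nonneg _) (pow_nonneg h.eps_pos.le _)
    _ = 24 * ε ^ 11 * ‖y - y'‖ := by ring

theorem norm_conv_v_le (h : TwoModeResonance ε σ g lam₀ q p v a b) (x : Coeff) :
    ‖conv v x‖ ≤ ε ^ 9 * ‖x‖ :=
  (norm_conv_le v x).trans (mul_le_mul_of_nonneg_right h.norm_v (norm_nonneg x))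

/-- This is where the rescaling by 16ε² pays: the coupling of the off-block part back to the block
becomes 16ε²·ε⁹, small against the gap 2ε¹⁰, whereas ε⁹ alone would not be. -/
theorem norm_source_sub_le (h : TwoModeResonance ε σ g lam₀ q p v a b) {y y' : ℂ × Coeff}
    (hy : ‖y‖ ≤ ε / 2) (hy' : ‖y'‖ ≤ ε / 2) :
    ‖source ε σ q v a b y - source ε σ q v a b y'‖ ≤ 40 * ε ^ 11 * ‖y - y'‖ := by
  rw [source, source, add_sub_add_comm, ← smul_sub, ← map_sub]
  refine (norm_add_le _ _).trans ?_
  rw [norm_smul, Complex.norm_real, Real.norm_of_nonneg (by positivity)]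
  have h1 := h.norm_conv_v_le (y.2 - y'.2)
  have h2 : ‖y.2 - y'.2‖ ≤ ‖y - y'‖ := norm_snd_le (y - y')
  have h3 := h.norm_cubic_ansatz_sub_le hy hy'
  have hε := h.eps_pos
  have h4 : 16 * ε ^ 2 * ‖conv v (y.2 - y'.2)‖ ≤ 16 * ε ^ 2 * (ε ^ 9 * ‖y - y'‖) := by
    gcongr
    exact h1.trans (by gcongr)
  nlinarith

/-- The main part is |σ|·2³ ≤ 8ε¹¹; the rest is O(ε¹²). The resulting 9 is the constant C of the
theorem. -/
theorem norm_source_le (h : TwoModeResonance ε σ g lam₀ q p v a b) {y : ℂ × Coeff}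
    (hy : ‖y‖ ≤ ε / 2) : ‖source ε σ q v a b y‖ ≤ 9 * ε ^ 11 := by
  have hε := h.eps_pos
  rw [source]
  refine (norm_add_le _ _).trans ?_
  rw [norm_smul, norm_smul, Complex.norm_real, Complex.norm_real,
    Real.norm_of_nonneg (by positivity), Real.norm_eq_abs]
  have h1 := h.norm_conv_v_le y.2
  have h2 : ‖y.2‖ ≤ ε / 2 := (norm_snd_le y).trans hy
  have h3 : ‖cubic (ansatz ε q a b y)‖ ≤ 2 ^ 3 :=
    (norm_cubic_le _).trans (pow_le_pow_left₀ (norm_nonneg _) (h.norm_ansatz_le hy) 3)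
  have h4 : 16 * ε ^ 2 * ‖conv v y.2‖ ≤ 16 * ε ^ 2 * (ε ^ 9 * (ε / 2)) := by
    gcongr
    exact h1.trans (by gcongr)
  have h5 : |σ| * ‖cubic (ansatz ε q a b y)‖ ≤ ε ^ 11 * 2 ^ 3 :=
    mul_le_mul h.coupling h3 (norm_nonneg _) (by positivity)
  have h6 : ε ^ 11 * ε ≤ ε ^ 11 * (1 / 1000) := by
    gcongr
    exact h.eps_le
  have h7 : 0 < ε ^ 11 := by positivity
  linarith

theorem norm_eigShift_le (h : TwoModeResonance ε σ g lam₀ q p v a b) {y : ℂ × Coeff}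
    (hy : ‖y‖ ≤ ε / 2) : ‖eigShift ε σ q v a b y‖ ≤ 9 * ε ^ 11 :=
  (norm_pair_le h.q_ne (by rw [RCLike.norm_conj]; exact h.norm_a_le)
    (by rw [RCLike.norm_conj]; exact h.norm_b_le) _).trans (h.norm_source_le hy)

theorem norm_eigShift_sub_le (h : TwoModeResonance ε σ g lam₀ q p v a b) {y y' : ℂ × Coeff}
    (hy : ‖y‖ ≤ ε / 2) (hy' : ‖y'‖ ≤ ε / 2) :
    ‖eigShift ε σ q v a b y - eigShift ε σ q v a b y'‖ ≤ 40 * ε ^ 11 * ‖y - y'‖ := by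
  rw [eigShift, eigShift, ← map_sub]
  exact (norm_pair_le h.q_ne (by rw [RCLike.norm_conj]; exact h.norm_a_le)
    (by rw [RCLike.norm_conj]; exact h.norm_b_le) _).trans (h.norm_source_sub_le hy hy')

theorem norm_inv_gap_mul_le (h : TwoModeResonance ε σ g lam₀ q p v a b) {z : ℂ} {r : ℝ}
    (hr : 0 ≤ r) (hz : ‖z‖ ≤ 2 * ε ^ 10 * r) : ‖(g : ℂ)⁻¹ * z‖ ≤ r := by
  rw [norm_mul, norm_inv, Complex.norm_real, Real.norm_of_nonneg h.gap_pos.le,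
    inv_mul_le_iff₀ h.gap_pos]
  exact hz.trans (mul_le_mul_of_nonneg_right h.gap hr)

theorem norm_inv_smul_diag_le (h : TwoModeResonance ε σ g lam₀ q p v a b) {x : Coeff} {r : ℝ}
    (hx : ‖x‖ ≤ 8 * ε ^ 8 * r) :
    ‖((16 * ε ^ 2 : ℝ) : ℂ)⁻¹ • diag (blockInv q p lam₀) (2 / ε ^ 6) h.norm_blockInv_le x‖ ≤ r := by
  have hε := h.eps_pos
  rw [norm_smul, norm_inv, Complex.norm_real, Real.norm_of_nonneg (by positivity),
    inv_mul_le_iff₀ (by positivity)]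
  refine (norm_diag_le _ _ _ x).trans ?_
  rw [div_mul_eq_mul_div, div_le_iff₀ (by positivity)]
  nlinarith

theorem norm_mul_sub_mul_le {V : Type*} [NormedAddCommGroup V] [NormedSpace ℂ V]
    (c c' : ℂ) (x x' : V) : ‖c • x - c' • x'‖ ≤ ‖c - c'‖ * ‖x‖ + ‖c'‖ * ‖x - x'‖ := by
  have : c • x - c' • x' = (c - c') • x + c' • (x - x') := by
    rw [sub_smul, smul_sub]
    abel
  rw [this]
  refine (norm_add_le _ _).trans ?_
  rw [norm_smul, norm_smul]

theorem norm_eigShift_smul_sub_le (h : TwoModeResonance ε σ g lam₀ q p v a b)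
    {V : Type*} [NormedAddCommGroup V] [NormedSpace ℂ V] {y y' : ℂ × Coeff}
    (hy : ‖y‖ ≤ ε / 2) (hy' : ‖y'‖ ≤ ε / 2) {x x' : V} (hx : ‖x‖ ≤ ε / 2)
    (hxx : ‖x - x'‖ ≤ ‖y - y'‖) :
    ‖eigShift ε σ q v a b y • x - eigShift ε σ q v a b y' • x'‖ ≤ 10 * ε ^ 11 * ‖y - y'‖ := by
  have hε := h.eps_pos
  refine (norm_mul_sub_mul_le _ _ _ _).trans ?_
  have h1 := mul_le_mul (h.norm_eigShift_sub_le hy hy') hx (norm_nonneg _) (by positivity)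
  have h2 := mul_le_mul (h.norm_eigShift_le hy') hxx (norm_nonneg _) (by positivity)
  have h3 : ε ^ 11 * ‖y - y'‖ * ε ≤ ε ^ 11 * ‖y - y'‖ * (1 / 1000) := by
    gcongr
    exact h.eps_le
  have h4 : 0 ≤ ε ^ 11 * ‖y - y'‖ := by positivity
  linarith

/-- On the block the numerators vary by at most 50ε¹¹ times the distance, against ε¹⁰ allowed by the
gap; off the block by about 2ε⁹, against the 4ε⁸ allowed by the divisors and the scaling. -/
theorem norm_iteration_sub_le (h : TwoModeResonance ε σ g lam₀ q p v a b) {y y' : ℂ × Coeff}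
    (hy : ‖y‖ ≤ ε / 2) (hy' : ‖y'‖ ≤ ε / 2) :
    ‖h.iteration y - h.iteration y'‖ ≤ 1 / 2 * ‖y - y'‖ := by
  have hε := h.eps_pos
  have hd := norm_nonneg (y - y')
  rw [Prod.norm_def, max_le_iff]
  constructor
  · rw [Prod.fst_sub, iteration, iteration, ← mul_sub]
    refine h.norm_inv_gap_mul_le (by positivity) ?_
    rw [sub_sub_sub_comm, ← map_sub]
    refine (norm_sub_le _ _).trans ?_
    have h1 := (norm_pair_le h.q_ne (by rw [norm_neg]; exact h.norm_b_le) h.norm_a_le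
      _).trans (h.norm_source_sub_le hy hy')
    have h2 := h.norm_eigShift_smul_sub_le hy hy' ((norm_fst_le y).trans hy)
      (norm_fst_le (y - y'))
    have h3 : ε ^ 10 * ‖y - y'‖ * ε ≤ ε ^ 10 * ‖y - y'‖ * (1 / 1000) := by
      gcongr
      exact h.eps_le
    have h4 : 0 ≤ ε ^ 10 * ‖y - y'‖ := by positivity
    simp only [smul_eq_mul] at h2
    linarith
  · rw [Prod.snd_sub, iteration, iteration, neg_sub_neg, ← smul_sub, ← map_sub]
    refine h.norm_inv_smul_diag_le ?_
    rw [norm_sub_rev, offSource, offSource, sub_sub_sub_comm, add_sub_add_comm, ← map_sub]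
    refine (norm_sub_le _ _).trans ((add_le_add (norm_add_le _ _) le_rfl).trans ?_)
    have h1 := h.norm_conv_v_le (ansatz ε q a b y - ansatz ε q a b y')
    have h2 := mul_le_mul_of_nonneg_left (h.norm_ansatz_sub_le y y') (pow_pos hε 9).le
    have h3 := h.norm_cubic_ansatz_sub_le hy hy'
    have hs : ‖((16 * ε ^ 2 : ℝ) : ℂ)‖ ≤ 1 := by
      rw [Complex.norm_real, Real.norm_of_nonneg (by positivity)]
      nlinarith [h.eps_le]
    have h4 := h.norm_eigShift_smul_sub_le hy hy'
      (x := ((16 * ε ^ 2 : ℝ) : ℂ) • y.2) (x' := ((16 * ε ^ 2 : ℝ) : ℂ) • y'.2)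
      (by
        rw [norm_smul]
        exact (mul_le_of_le_one_left (norm_nonneg _) hs).trans ((norm_snd_le y).trans hy))
      (by
        rw [← smul_sub, norm_smul]
        exact (mul_le_of_le_one_left (norm_nonneg _) hs).trans (norm_snd_le (y - y')))
    have h5 : ε ^ 8 * ‖y - y'‖ * ε ≤ ε ^ 8 * ‖y - y'‖ * (1 / 1000) := by
      gcongr
      exact h.eps_le
    have h6 : ε ^ 8 * ‖y - y'‖ * ε ^ 3 ≤ ε ^ 8 * ‖y - y'‖ * (1 / 1000) ^ 3 := by
      gcongr
      exact h.eps_le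
    have h7 : 0 ≤ ε ^ 8 * ‖y - y'‖ := by positivity
    linarith

theorem norm_iteration_zero_le (h : TwoModeResonance ε σ g lam₀ q p v a b) :
    ‖h.iteration 0‖ ≤ ε / 4 := by
  have hε := h.eps_pos
  have hans : ansatz ε q a b 0 = twoMode q a b := by simp [ansatz, correction]
  have hsrc : source ε σ q v a b 0 = (σ : ℂ) • cubic (twoMode q a b) := by
    simp [source, hans]
  rw [Prod.norm_def, max_le_iff]
  constructor
  · rw [iteration]
    refine h.norm_inv_gap_mul_le (by positivity) ?_
    rw [Prod.fst_zero, mul_zero, sub_zero, hsrc, map_smul, norm_smul, Complex.norm_real,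
      Real.norm_eq_abs]
    -- The numerator is at most ε¹¹/2, and division by the gap 2ε¹⁰ gives exactly ε/4.
    have := mul_le_mul h.coupling (norm_pair_cubic_twoMode_le h.q_ne h.unit) (norm_nonneg _)
      (by positivity)
    linarith
  · rw [iteration, norm_neg]
    refine h.norm_inv_smul_diag_le ?_
    rw [offSource, hans, Prod.snd_zero, smul_zero, smul_zero, sub_zero]
    refine (norm_add_le _ _).trans ?_
    rw [norm_smul, Complex.norm_real, Real.norm_eq_abs]
    have h0 := (norm_twoMode_le q a b).trans h.norm_a_add_norm_b_le
    -- The leading term 3ε⁹/2 fits below 8ε⁸·ε/4 = 2ε⁹; this fixes how large the factor 16 has to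
    -- be.
    have h1 := (h.norm_conv_v_le _).trans (mul_le_mul_of_nonneg_left h0 (pow_pos hε 9).le)
    have h2 := mul_le_mul h.coupling
      ((norm_cubic_le _).trans (pow_le_pow_left₀ (norm_nonneg _) h0 3)) (norm_nonneg _)
      (by positivity)
    have h3 : ε ^ 9 * ε ^ 2 ≤ ε ^ 9 * (1 / 1000) ^ 2 := by
      gcongr
      exact h.eps_le
    have h4 : 0 < ε ^ 9 := by positivity
    linarith

theorem exists_fixedPoint (h : TwoModeResonance ε σ g lam₀ q p v a b) :
    ∃ y : ℂ × Coeff, ‖y‖ ≤ ε / 2 ∧ h.iteration y = y := by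
  have hε := h.eps_pos
  have hmaps : Set.MapsTo h.iteration (Metric.closedBall 0 (ε / 2)) (Metric.closedBall 0 (ε / 2)) := by
    intro y hy
    rw [mem_closedBall_zero_iff] at hy ⊢
    -- The ball is mapped into itself because ½·ε/2 + ε/4 = ε/2.
    have h1 := h.norm_iteration_sub_le hy (y' := 0) (by rw [norm_zero]; positivity)
    have h2 := h.norm_iteration_zero_le
    have h3 := norm_le_norm_add_norm_sub' (h.iteration y) (h.iteration 0)
    rw [sub_zero] at h1
    linarith
  have hc : ContractingWith (1 / 2) (hmaps.restrict h.iteration _ _) := by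
    refine ⟨by norm_num, LipschitzWith.of_dist_le_mul fun y y' => ?_⟩
    have := h.norm_iteration_sub_le (mem_closedBall_zero_iff.mp y.2)
      (mem_closedBall_zero_iff.mp y'.2)
    rw [← dist_eq_norm, ← dist_eq_norm] at this
    simpa [Subtype.dist_eq] using this
  obtain ⟨y, hy, hfix, -⟩ := ContractingWith.exists_fixedPoint' Metric.isClosed_closedBall.isComplete
    hmaps hc (Metric.mem_closedBall_self (by positivity)) (edist_ne_top _ _)
  exact ⟨y, mem_closedBall_zero_iff.mp hy, hfix⟩

theorem unit_complex (h : TwoModeResonance ε σ g lam₀ q p v a b) :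
    a * (starRingEnd ℂ) a + b * (starRingEnd ℂ) b = 1 := by
  rw [Complex.mul_conj', Complex.mul_conj']
  exact_mod_cast h.unit

theorem ansatz_apply_zero (hq : q ≠ 0) {y : ℂ × Coeff} (hy : y.2 0 = 0) :
    ansatz ε q a b y 0 = a - y.1 * (starRingEnd ℂ) b := by
  rw [ansatz, correction, Coeff.add_apply, Coeff.add_apply, Coeff.smul_apply, Coeff.smul_apply,
    twoMode_apply_zero hq, twoMode_apply_zero hq, hy]
  ring

theorem ansatz_apply_neg (hq : q ≠ 0) {y : ℂ × Coeff} (hy : y.2 (-q) = 0) :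
    ansatz ε q a b y (-q) = b + y.1 * (starRingEnd ℂ) a := by
  rw [ansatz, correction, Coeff.add_apply, Coeff.add_apply, Coeff.smul_apply, Coeff.smul_apply,
    twoMode_apply_neg hq, twoMode_apply_neg hq, hy]
  ring

theorem ansatz_apply_of_ne {m : Idx} (h0 : m ≠ 0) (h1 : m ≠ -q) (y : ℂ × Coeff) :
    ansatz ε q a b y m = ((16 * ε ^ 2 : ℝ) : ℂ) * y.2 m := by
  rw [ansatz, correction, Coeff.add_apply, Coeff.add_apply, Coeff.smul_apply, Coeff.smul_apply,
    twoMode_apply_of_ne h0 h1, twoMode_apply_of_ne h0 h1]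
  ring

theorem conv_ansatz_add_apply (y : ℂ × Coeff) (m : Idx) :
    conv v (ansatz ε q a b y) m + σ * cubic (ansatz ε q a b y) m
      = v m * (a - y.1 * (starRingEnd ℂ) b) + v (m + q) * (b + y.1 * (starRingEnd ℂ) a)
        + source ε σ q v a b y m := by
  have : conv v (ansatz ε q a b y) m = v m * a + v (m + q) * b
      + (y.1 * (v m * -(starRingEnd ℂ) b + v (m + q) * (starRingEnd ℂ) a)
        + ((16 * ε ^ 2 : ℝ) : ℂ) * conv v y.2 m) := by
    rw [ansatz, correction, map_add, map_add, map_smul, map_smul, Coeff.add_apply,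
      Coeff.add_apply, Coeff.smul_apply, Coeff.smul_apply, conv_twoMode_apply, conv_twoMode_apply]
  rw [this, source, Coeff.add_apply, Coeff.smul_apply, Coeff.smul_apply]
  ring

theorem exists_solution (h : TwoModeResonance ε σ g lam₀ q p v a b) :
    ∃ (f w : Coeff) (μ : ℂ), f = twoMode q a b + w ∧ ‖w‖ ≤ ε ∧ ‖μ‖ ≤ 9 * ε ^ 11 ∧
      (starRingEnd ℂ) a * f 0 + (starRingEnd ℂ) b * f (-q) = 1 ∧
      ∀ m, ((p m : ℂ) - lam₀ - μ) * f m + conv v f m + σ * cubic f m = 0 := by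
  have hε := h.eps_pos
  obtain ⟨y, hy, hfix⟩ := h.exists_fixedPoint
  have hs : ((16 * ε ^ 2 : ℝ) : ℂ) ≠ 0 := by
    exact_mod_cast (by positivity : (16 * ε ^ 2 : ℝ) ≠ 0)
  have hg : (g : ℂ) ≠ 0 := by exact_mod_cast h.gap_pos.ne'
  have hfst := congr_arg Prod.fst hfix
  have hsnd : ∀ m, ((16 * ε ^ 2 : ℝ) : ℂ) * y.2 m
      = -(blockInv q p lam₀ m * offSource ε σ q v a b y m) := fun m => by
    have := congr_arg (fun z : ℂ × Coeff => z.2 m) hfix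
    simp only [iteration, Coeff.neg_apply, Coeff.smul_apply, diag_apply] at this
    rw [← this]
    field_simp
  -- The inverse is set to zero on the block, so a fixed point has no off-block component at 0 or
  -- -q.
  have hy0 : y.2 0 = 0 := by
    have := hsnd 0
    rw [blockInv, if_pos (Or.inl rfl), zero_mul, neg_zero] at this
    exact (mul_eq_zero.mp this).resolve_left hs
  have hyq : y.2 (-q) = 0 := by
    have := hsnd (-q)
    rw [blockInv, if_pos (Or.inr rfl), zero_mul, neg_zero] at this
    exact (mul_eq_zero.mp this).resolve_left hs
  have hf0 := ansatz_apply_zero (ε := ε) (a := a) (b := b) h.q_ne hy0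
  have hfq := ansatz_apply_neg (ε := ε) (a := a) (b := b) h.q_ne hyq
  have hu := h.unit_complex
  have hβ : (g : ℂ) * y.1 = -b * source ε σ q v a b y 0 + a * source ε σ q v a b y (-q)
      - eigShift ε σ q v a b y * y.1 := by
    rw [← pair_apply]
    exact ((inv_mul_eq_iff_eq_mul₀ hg).mp hfst).symm
  have hμ : eigShift ε σ q v a b y = (starRingEnd ℂ) a * source ε σ q v a b y 0
      + (starRingEnd ℂ) b * source ε σ q v a b y (-q) := rfl
  refine ⟨ansatz ε q a b y, correction ε q a b y, eigShift ε σ q v a b y, rfl,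
    h.norm_correction_le hy, h.norm_eigShift_le hy, ?_, fun m => ?_⟩
  · rw [hf0, hfq]
    linear_combination hu
  · have r0 := h.row_zero
    have r1 := h.row_neg
    have r0' := h.row_zero_orth
    have r1' := h.row_neg_orth
    push_cast at r0 r1 r0' r1'
    by_cases hm0 : m = 0
    · subst hm0
      rw [add_assoc, conv_ansatz_add_apply, hf0, h.v_zero, zero_add]
      -- The block entries of the source are rebuilt from their components along the orthonormal
      -- pair (a, b), (-b̄, ā), which are μ and (g + μ)β.
      linear_combination r0 + y.1 * r0' - a * hμ + (starRingEnd ℂ) b * hβ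
        - source ε σ q v a b y 0 * hu
    by_cases hmq : m = -q
    · subst hmq
      rw [add_assoc, conv_ansatz_add_apply, hfq, neg_add_cancel, h.v_zero]
      linear_combination r1 + y.1 * r1' - b * hμ - (starRingEnd ℂ) a * hβ
        - source ε σ q v a b y (-q) * hu
    · have hD : (p m : ℂ) - lam₀ ≠ 0 := by
        have h1 := h.sep m hm0 hmq
        have h2 : p m - lam₀ ≠ 0 := fun h0 => by
          rw [h0, abs_zero] at h1
          nlinarith [pow_pos hε 6]
        exact_mod_cast h2
      have h1 := hsnd m
      rw [blockInv, if_neg (by tauto), offSource, Coeff.sub_apply, Coeff.add_apply,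
        Coeff.smul_apply, Coeff.smul_apply, Coeff.smul_apply] at h1
      push_cast at h1
      rw [ansatz_apply_of_ne hm0 hmq]
      push_cast
      field_simp at h1
      linear_combination h1

end TwoModeResonance

/-! ### Reality of the eigenvalue. -/

theorem Coeff.summable_conv_apply (f g : Coeff) (m : Idx) :
    Summable fun n => f n * g (m - n) := by
  refine Summable.of_norm_bounded (f.summable_norm.mul_right ‖g‖) fun n => ?_
  rw [norm_mul]
  exact mul_le_mul_of_nonneg_left (norm_apply_le _ _) (norm_nonneg _)

/-- A nonlinear eigenvalue of a problem with real potential is real. -/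
theorem im_eigenvalue_eq_zero {p : Idx → ℝ} {v f : Coeff} {σ : ℝ} {lam : ℂ} (hv : dag v = v)
    (hf : f ≠ 0)
    (heq : ∀ m, ((p m : ℂ) - lam) * f m + conv v f m + σ * cubic f m = 0) : lam.im = 0 := by
  -- The sequence (p_m - lam) f_m is not evidently in ℓ¹, as p is unbounded; the equation writes it
  -- as one that is. Its product with the conjugate of F is the real function -(V|F|² + σ|F|⁴), so
  -- the zeroth coefficient is real.
  let r : Coeff := -(conv v f + (σ : ℂ) • cubic f)
  have hr : ∀ m, r m = ((p m : ℂ) - lam) * f m := fun m => by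
    have h1 : r m = -(conv v f m + σ * cubic f m) := rfl
    rw [h1]
    linear_combination -heq m
  have hreal : dag (conv (dag f) r) = conv (dag f) r := by
    refine synth_injective fun x => ?_
    have hV : (starRingEnd ℂ) (synth x v) = synth x v := by rw [← synth_dag, hv]
    rw [synth_dag, synth_conv, synth_dag, map_neg, map_add, map_smul, synth_conv, synth_cubic]
    simp only [map_mul, map_neg, map_add, Complex.conj_conj, hV, smul_eq_mul, Complex.conj_ofReal,
      map_pow]
    ring
  have him : (conv (dag f) r 0).im = 0 := by
    rw [← Complex.conj_eq_iff_im]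
    have := dag_apply (conv (dag f) r) 0
    rw [hreal, neg_zero] at this
    exact this.symm
  -- Since p is real, the same zeroth coefficient has imaginary part -Im(lam)·∑|f_m|².
  have hterm : ∀ n, (dag f n * r (0 - n)).im = -lam.im * ‖f (-n)‖ ^ 2 := fun n => by
    rw [hr, zero_sub, dag_apply, mul_left_comm, Complex.conj_mul', ← Complex.ofReal_pow,
      Complex.im_mul_ofReal]
    simp
  rw [conv_apply] at him
  have him' := Complex.imCLM.map_tsum ((dag f).summable_conv_apply r 0)
  simp only [Complex.imCLM_apply, hterm] at him'
  rw [him, tsum_mul_left] at him'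
  by_contra hne
  have hsum0 : ∑' n, ‖f (-n)‖ ^ 2 = 0 :=
    (mul_eq_zero.mp him'.symm).resolve_left (neg_ne_zero.mpr hne)
  have hs : Summable fun n => ‖f (-n)‖ ^ 2 := by
    refine Summable.of_nonneg_of_le (fun n => by positivity) (fun n => ?_)
      (((Equiv.neg Idx).summable_iff.mpr f.summable_norm).mul_left ‖f‖)
    rw [sq]
    exact mul_le_mul_of_nonneg_right (norm_apply_le _ _) (norm_nonneg _)
  have hzero := (hasSum_zero_iff_of_nonneg fun n => by positivity).mp (hsum0 ▸ hs.hasSum)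
  refine hf ?_
  ext m
  have := congr_fun hzero (-m)
  simpa using this

/-! ### From coefficients to classical quasi-periodic solutions. -/

theorem P_add (j m : Idx) (t : Plane) : P (j + m) t = P j t + latticeVec m := by
  rw [P, P, latticeVec_add]
  abel

/-- No decay beyond ℓ¹ is assumed: the equation expresses p²_{j+m} f_m through terms already in ℓ¹.
The weighted summability obtained this way gives C² regularity and the termwise Laplacian. -/
theorem isSolution_of_coeff {v : Idx →₀ ℂ} {j : Idx} {t : Plane} {f : Coeff} {σ lam : ℝ} {B : ℂ}
    (heq : ∀ m, ((pSq (j + m) t : ℂ) - lam) * f m + conv (Coeff.ofFinsupp v) f m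
      + ((σ * ‖B‖ ^ 2 : ℝ) : ℂ) * cubic f m = 0) :
    IsSolution (trigPoly v) σ lam fun x => B * planeWave (P j t) x * synth x f := by
  let G : Coeff := (lam : ℂ) • f - conv (Coeff.ofFinsupp v) f
    - ((σ * ‖B‖ ^ 2 : ℝ) : ℂ) • cubic f
  have hG : ∀ m, G m = (pSq (j + m) t : ℂ) * f m := fun m => by
    have h1 : G m = lam * f m - conv (Coeff.ofFinsupp v) f m
      - ((σ * ‖B‖ ^ 2 : ℝ) : ℂ) * cubic f m := rfl
    rw [h1]
    linear_combination -heq m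
  have hu : (fun x => B * planeWave (P j t) x * synth x f)
      = fun x => ∑' m, (B * f m) * planeWave (P (j + m) t) x := by
    ext x
    rw [synth_apply, ← tsum_mul_left]
    refine tsum_congr fun m => ?_
    rw [P_add, planeWave_add]
    ring
  have h0 : Summable fun m => ‖B * f m‖ := by
    simp_rw [norm_mul]
    exact f.summable_norm.mul_left _
  have h2 : Summable fun m => ‖B * f m‖ * ‖P (j + m) t‖ ^ 2 := by
    refine (G.summable_norm.mul_left ‖B‖).congr fun m => ?_
    rw [hG, norm_mul, norm_mul, Complex.norm_real, pSq, Real.norm_of_nonneg (by positivity)]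
    ring
  refine ⟨hu ▸ contDiff_tsum_planeWave h0 h2, fun x => ?_⟩
  have hlap : Laplacian.laplacian (fun x => B * planeWave (P j t) x * synth x f) x
      = -(B * planeWave (P j t) x * synth x G) := by
    rw [hu, laplacian_tsum_planeWave h0 h2, synth_apply, ← tsum_mul_left]
    congr 1
    refine tsum_congr fun m => ?_
    rw [hG, P_add, planeWave_add, ← P_add, pSq]
    ring
  have hsG : synth x G = lam * synth x f - trigPoly v x * synth x f
      - ((σ * ‖B‖ ^ 2 : ℝ) : ℂ) * ((‖synth x f‖ : ℂ) ^ 2 * synth x f) := by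
    rw [map_sub, map_sub, map_smul, map_smul, synth_conv, synth_cubic, synth_ofFinsupp,
      smul_eq_mul, smul_eq_mul]
  rw [hlap, hsG, norm_mul, norm_mul, norm_planeWave]
  push_cast
  ring

theorem isQuasiPeriodic_of_translate {t : Plane} {u : Plane → ℂ} (hd : Differentiable ℝ u)
    (h : ∀ x s, u (x + period s) = Complex.exp (2 * Real.pi * Complex.I * (t s : ℂ)) * u x) :
    IsQuasiPeriodic t u := by
  refine fun x s => ⟨h x s, ?_⟩
  rw [partialDeriv, partialDeriv, ← fderiv_comp_add_right]
  simp_rw [h _ s]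
  rw [fderiv_const_mul (hd x), _root_.smul_apply, smul_eq_mul]

theorem isQuasiPeriodic_planeWave_mul {j : Idx} {t : Plane} {B : ℂ} {F : Plane → ℂ}
    (hd : Differentiable ℝ fun x => B * planeWave (P j t) x * F x) (hF : IsPeriodic F) :
    IsQuasiPeriodic t fun x => B * planeWave (P j t) x * F x := by
  refine isQuasiPeriodic_of_translate hd fun x s => ?_
  have hP : P j t s = (j s : ℝ) + t s := rfl
  rw [hF, planeWave_add_period, hP, Complex.ofReal_add, mul_add, Complex.exp_add,
    exp_two_pi_mul_int]
  ring

/-! ### The 2×2 model matrix. -/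

section Block

variable (v : Idx →₀ ℂ) (q j : Idx) (t : Plane)

/-- The distance between the two eigenvalues of the model matrix. -/
def spectralGap : ℝ := Real.sqrt (4 * ‖v q‖ ^ 2 + (pSq j t - pSq (j - q) t) ^ 2)

/-- The Euclidean length of the eigenvector `ePlus`. -/
def ePlusNorm : ℝ := Real.sqrt ((pSq (j - q) t - lambdaPlus v q j t) ^ 2 + ‖v (-q)‖ ^ 2)

/-- The component at `j` of the normalised eigenvector. -/
def unitFst : ℝ := (pSq (j - q) t - lambdaPlus v q j t) / ePlusNorm v q j t

/-- The component at `j - q` of the normalised eigenvector. -/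
def unitSnd : ℂ := -v (-q) / ePlusNorm v q j t

variable {v q j t}

theorem lambdaPlus_eq :
    lambdaPlus v q j t = (pSq j t + pSq (j - q) t) / 2 + spectralGap v q j t / 2 := rfl

theorem sq_spectralGap :
    spectralGap v q j t ^ 2 = 4 * ‖v q‖ ^ 2 + (pSq j t - pSq (j - q) t) ^ 2 :=
  Real.sq_sqrt (by positivity)

theorem two_mul_norm_le_spectralGap : 2 * ‖v q‖ ≤ spectralGap v q j t := by
  refine Real.le_sqrt_of_sq_le ?_
  nlinarith [sq_nonneg (pSq j t - pSq (j - q) t)]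

/-- The characteristic equation of the model matrix at its upper eigenvalue; its companion below is
the trace. -/
theorem sub_lambdaPlus_mul :
    (pSq j t - lambdaPlus v q j t) * (pSq (j - q) t - lambdaPlus v q j t) = ‖v q‖ ^ 2 := by
  rw [lambdaPlus_eq]
  linear_combination sq_spectralGap (v := v) (q := q) (j := j) (t := t) / 4

theorem sub_lambdaPlus_add :
    (pSq j t - lambdaPlus v q j t) + (pSq (j - q) t - lambdaPlus v q j t)
      = -spectralGap v q j t := by
  rw [lambdaPlus_eq]
  ring

theorem IsRealMeanZero.norm_neg (hv : IsRealMeanZero v) (q : Idx) : ‖v (-q)‖ = ‖v q‖ := by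
  rw [hv.real, RCLike.norm_conj]

theorem sq_ePlusNorm :
    ePlusNorm v q j t ^ 2 = (pSq (j - q) t - lambdaPlus v q j t) ^ 2 + ‖v (-q)‖ ^ 2 :=
  Real.sq_sqrt (by positivity)

theorem ePlusNorm_pos (hq : v (-q) ≠ 0) : 0 < ePlusNorm v q j t := by
  have := norm_pos_iff.mpr hq
  exact Real.sqrt_pos.mpr (by positivity)

theorem unitFst_sq_add (hq : v (-q) ≠ 0) :
    ‖(unitFst v q j t : ℂ)‖ ^ 2 + ‖unitSnd v q j t‖ ^ 2 = 1 := by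
  have hν := ePlusNorm_pos (j := j) (t := t) hq
  rw [Complex.norm_real, Real.norm_eq_abs, sq_abs, unitFst, unitSnd, norm_div, norm_neg,
    Complex.norm_real, Real.norm_of_nonneg hν.le, div_pow, div_pow, ← add_div, ← sq_ePlusNorm,
    div_self (by positivity)]

/-- The column at j of the rank-one projection is the unit eigenvector times the conjugate of its
component at j, and that component is real. -/
theorem psi_eq_synth (x : Plane) :
    psi v q j t x = synth x ((unitFst v q j t : ℂ) •
      twoMode q (unitFst v q j t : ℂ) (unitSnd v q j t)) := by
  have hsum : (∑ i, ‖ePlus v q j t i‖ ^ 2 : ℝ) = ePlusNorm v q j t ^ 2 := by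
    rw [sq_ePlusNorm, Fin.sum_univ_two]
    simp only [ePlus, Matrix.cons_val_zero, Matrix.cons_val_one, norm_neg, Complex.norm_real,
      Real.norm_eq_abs, sq_abs]
  rw [smul_twoMode, twoMode, map_add, synth_mono, synth_mono, latticeVec_zero, planeWave_zero,
    latticeVec_neg, psi, projPlus, hsum]
  simp only [Matrix.smul_apply, Matrix.vecMulVec_apply, Pi.star_apply, ePlus, Matrix.cons_val_zero,
    Matrix.cons_val_one, smul_eq_mul, RCLike.star_def, Complex.conj_ofReal, unitFst, unitSnd]
  push_cast
  ring

theorem twoModeResonance_of_separated {ε σ : ℝ} (hε : 0 < ε) (hε' : ε ≤ 1 / 1000)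
    (hv : IsRealMeanZero v) (hnorm : ‖Coeff.ofFinsupp v‖ ≤ ε ^ 9) (hq : ε ^ 10 < ‖v q‖)
    (hσ : |σ| ≤ ε ^ 11)
    (hsep : ∀ m, m ≠ j → m ≠ j - q → ε ^ 6 ≤ 2 * |pSq m t - lambdaPlus v q j t|) :
    TwoModeResonance ε σ (spectralGap v q j t) (lambdaPlus v q j t) q (fun m => pSq (j + m) t)
      (Coeff.ofFinsupp v) (unitFst v q j t) (unitSnd v q j t) := by
  have hvq : v q ≠ 0 := norm_pos_iff.mp (lt_trans (by positivity) hq)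
  have hvq' : v (-q) ≠ 0 := norm_pos_iff.mp (by rw [hv.norm_neg]; exact norm_pos_iff.mpr hvq)
  have hν : (ePlusNorm v q j t : ℂ) ≠ 0 := by
    exact_mod_cast (ePlusNorm_pos (j := j) (t := t) hvq').ne'
  have hmul : ((pSq j t : ℂ) - lambdaPlus v q j t) * (pSq (j - q) t - lambdaPlus v q j t)
      = v q * v (-q) := by
    rw [hv.real, Complex.mul_conj']
    exact_mod_cast sub_lambdaPlus_mul
  have hadd : ((pSq j t : ℂ) - lambdaPlus v q j t) + (pSq (j - q) t - lambdaPlus v q j t)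
      = -spectralGap v q j t := by
    exact_mod_cast sub_lambdaPlus_add
  have hconj : (starRingEnd ℂ) (v (-q)) = v q := by rw [hv.real, Complex.conj_conj]
  refine ⟨hε, hε', ?_, hnorm, hv.mean_zero, unitFst_sq_add hvq', ?_, ?_, ?_, ?_, ?_, ?_, hσ⟩
  · rintro rfl
    exact hvq hv.mean_zero
  · simp only [add_zero, Coeff.ofFinsupp_apply, unitFst, unitSnd]
    push_cast
    field_simp
    linear_combination hmul
  · simp only [← sub_eq_add_neg, Coeff.ofFinsupp_apply, unitFst, unitSnd]
    push_cast
    field_simp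
    ring
  · simp only [add_zero, Coeff.ofFinsupp_apply, unitFst, unitSnd,
      Complex.conj_ofReal, map_div₀, map_neg, hconj]
    push_cast
    field_simp
    linear_combination hadd
  · simp only [← sub_eq_add_neg, Coeff.ofFinsupp_apply, unitFst, unitSnd,
      Complex.conj_ofReal, map_div₀, map_neg, hconj]
    push_cast
    field_simp
    linear_combination -hmul + ((pSq (j - q) t : ℂ) - lambdaPlus v q j t) * hadd
  · linarith [two_mul_norm_le_spectralGap (v := v) (q := q) (j := j) (t := t)]
  · intro m h0 h1
    refine hsep (j + m) (fun h => h0 (by simpa using h)) fun h => h1 ?_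
    rw [sub_eq_add_neg] at h
    exact add_left_cancel h

/-- By the characteristic equation, a factor p_j² - λ̂⁺ of size at least ε⁶ makes the other at most
|v_q|²/ε⁶ ≤ ε³|v_q|. That other factor is the j-component of an eigenvector of length at least
|v_q|. -/
theorem abs_unitFst_le {ε : ℝ} (hε : 0 < ε) (hv : IsRealMeanZero v) (hq : ‖v q‖ ≤ ε ^ 9)
    (hvq : v (-q) ≠ 0) (hfar : ε ^ 6 ≤ |pSq j t - lambdaPlus v q j t|) :
    |unitFst v q j t| ≤ ε ^ 3 := by
  have hν := ePlusNorm_pos (j := j) (t := t) hvq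
  have hw : 0 < ‖v q‖ := by rw [← hv.norm_neg]; exact norm_pos_iff.mpr hvq
  have hle : ‖v q‖ ≤ ePlusNorm v q j t := by
    refine Real.le_sqrt_of_sq_le ?_
    rw [hv.norm_neg]
    nlinarith [sq_nonneg (pSq (j - q) t - lambdaPlus v q j t)]
  have hprod : |pSq j t - lambdaPlus v q j t| * |pSq (j - q) t - lambdaPlus v q j t|
      = ‖v q‖ ^ 2 := by
    rw [← abs_mul, sub_lambdaPlus_mul, abs_of_nonneg (by positivity)]
  rw [unitFst, abs_div, abs_of_pos hν, div_le_iff₀ hν]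
  have h1 : ε ^ 6 * |pSq (j - q) t - lambdaPlus v q j t| ≤ ε ^ 6 * (ε ^ 3 * ‖v q‖) := by
    have := mul_le_mul_of_nonneg_right hfar (abs_nonneg (pSq (j - q) t - lambdaPlus v q j t))
    nlinarith
  have h2 := le_of_mul_le_mul_left h1 (by positivity)
  exact h2.trans (by gcongr)

end Block

/-! ### Moving the quasimomentum, and the two cases of the theorem. -/

theorem norm_P_sub_le (m : Idx) (t t₀ : Plane) : |‖P m t‖ - ‖P m t₀‖| ≤ dist t t₀ := by
  refine (abs_norm_sub_norm_le _ _).trans_eq ?_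
  rw [P, P, add_sub_add_left_eq_sub, dist_eq_norm]

theorem abs_pSq_sub_le (m : Idx) (t t₀ : Plane) :
    |pSq m t - pSq m t₀| ≤ dist t t₀ * (‖P m t‖ + ‖P m t₀‖) := by
  rw [pSq, pSq, sq_sub_sq, abs_mul, mul_comm,
    abs_of_nonneg (add_nonneg (norm_nonneg (P m t)) (norm_nonneg (P m t₀)))]
  exact mul_le_mul_of_nonneg_right (norm_P_sub_le m t t₀) (by positivity)

/-- If another free eigenvalue is close to `L`, then `p_j²(t)` is not. -/
theorem far_of_isResonantIndex {ε k L : ℝ} {q j m : Idx} {t t₀ : Plane} (hε : 0 < ε)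
    (hε' : ε ≤ 1 / 1000) (hk : 1 < k) (hj : IsResonantIndex q k ε t₀ j)
    (ht : dist t t₀ < k⁻¹ * ε ^ 7) (hm : m ≠ j) (hm' : m ≠ j - q)
    (hL : 2 * |pSq m t - L| < ε ^ 6) : ε ^ 6 ≤ |pSq j t - L| := by
  by_contra! hfar
  have hδ : k * dist t t₀ < ε ^ 7 := by
    rw [inv_mul_eq_div, lt_div_iff₀ (by linarith)] at ht
    linarith
  have hd := dist_nonneg (x := t) (y := t₀)
  have h67 : ε ^ 7 ≤ ε ^ 6 / 1000 := by
    rw [pow_succ]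
    nlinarith [pow_pos hε 6]
  have h6 : ε ^ 6 ≤ 1 := pow_le_one₀ hε.le (by linarith)
  have hd1 : dist t t₀ ≤ 1 := by nlinarith
  have hPj := abs_le.mp (norm_P_sub_le j t t₀)
  rw [hj.on_circle] at hPj
  have hPm := abs_le.mp (norm_P_sub_le m t t₀)
  -- If both were close to L, they would be within 3ε⁶/2 of each other at t. Passing to t₀ costs at
  -- most 13ε⁷, which contradicts the separation 2ε⁶.
  have hmj : |pSq j t - pSq m t| < 3 / 2 * ε ^ 6 := by
    have := abs_sub_le (pSq j t) L (pSq m t)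
    rw [abs_sub_comm L] at this
    linarith
  -- Closeness to p_j² keeps |P_m| of order k, so that a displacement below ε⁷/k changes p_m² only
  -- by O(ε⁷).
  have hPm' : ‖P m t‖ ≤ k + 3 := by
    refine abs_le_of_sq_le_sq' ?_ (by linarith) |>.2
    have h1 := (abs_lt.mp hmj).1
    have h2 : ‖P j t‖ ^ 2 ≤ (k + 1) ^ 2 := pow_le_pow_left₀ (norm_nonneg _) (by linarith) 2
    rw [pSq, pSq] at h1
    nlinarith
  have hj1 : |pSq j t - pSq j t₀| ≤ 3 * ε ^ 7 := by
    refine (abs_pSq_sub_le j t t₀).trans ?_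
    rw [hj.on_circle]
    nlinarith
  have hm1 : |pSq m t - pSq m t₀| ≤ 10 * ε ^ 7 := by
    refine (abs_pSq_sub_le m t t₀).trans ?_
    nlinarith
  have hsep := hj.separated m hm hm'
  have h1 := abs_sub_le (pSq j t₀) (pSq j t) (pSq m t₀)
  have h2 := abs_sub_le (pSq j t) (pSq m t) (pSq m t₀)
  rw [abs_sub_comm (pSq j t₀) (pSq j t)] at h1
  linarith [pow_pos hε 6]

theorem exists_solution_of_separated {ε : ℝ} (hε : 0 < ε) (hε' : ε ≤ 1 / 1000) {v : Idx →₀ ℂ}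
    (hv : IsRealMeanZero v) (hnorm : ‖Coeff.ofFinsupp v‖ ≤ ε ^ 9) {q j : Idx} {t : Plane}
    (hq : ε ^ 10 < ‖v q‖) {σ : ℝ} {A : ℂ} (hσ : |σ| * ‖A‖ ^ 2 < ε ^ 11)
    (hsep : ∀ m, m ≠ j → m ≠ j - q → ε ^ 6 ≤ 2 * |pSq m t - lambdaPlus v q j t|) :
    ∃ (u w : Plane → ℂ) (lam : ℝ), IsSolution (trigPoly v) σ lam u ∧ IsQuasiPeriodic t u ∧
      (∀ x, u x = A * planeWave (P j t) x * (psi v q j t x + w x)) ∧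
      |lam - lambdaPlus v q j t| ≤ 9 * ε ^ 11 ∧
      Continuous w ∧ IsPeriodic w ∧ starNorm w ≤ ENNReal.ofReal ε ∧ (A ≠ 0 → u ≠ 0) := by
  set a := unitFst v q j t with ha
  have hvq : v (-q) ≠ 0 :=
    norm_pos_iff.mp (by rw [hv.norm_neg]; exact lt_trans (by positivity) hq)
  have hle : ‖(a : ℂ)‖ ≤ 1 := by
    nlinarith [unitFst_sq_add (j := j) (t := t) hvq, sq_nonneg ‖unitSnd v q j t‖,
      norm_nonneg (a : ℂ)]
  -- The amplitude in front of f is A a, so the effective coupling is σ|A a|².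
  have hσ' : |σ * ‖A * a‖ ^ 2| ≤ ε ^ 11 := by
    rw [abs_mul, abs_of_nonneg (sq_nonneg ‖A * a‖), norm_mul]
    refine le_trans ?_ hσ.le
    gcongr
    exact mul_le_of_le_one_right (norm_nonneg _) hle
  have H := twoModeResonance_of_separated hε hε' hv hnorm hq hσ' hsep
  obtain ⟨f, w, μ, hfw, hw, hμ, hone, heq⟩ := H.exists_solution
  have hdag : dag (Coeff.ofFinsupp v) = Coeff.ofFinsupp v := by
    ext m
    rw [dag_apply, Coeff.ofFinsupp_apply, Coeff.ofFinsupp_apply, hv.real, Complex.conj_conj]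
  have hf0 : f ≠ 0 := by
    rintro rfl
    simp at hone
  have heq' : ∀ m, ((pSq (j + m) t : ℂ) - (lambdaPlus v q j t + μ)) * f m
      + conv (Coeff.ofFinsupp v) f m + ((σ * ‖A * a‖ ^ 2 : ℝ) : ℂ) * cubic f m = 0 := fun m => by
    rw [← sub_sub]
    exact heq m
  have him := im_eigenvalue_eq_zero hdag hf0 heq'
  have hμre : μ = (μ.re : ℂ) := by
    refine Complex.ext rfl ?_
    simpa using him
  have hsol : IsSolution (trigPoly v) σ (lambdaPlus v q j t + μ.re)
      fun x => (A * a) * planeWave (P j t) x * synth x f := by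
    refine isSolution_of_coeff fun m => ?_
    rw [Complex.ofReal_add, ← hμre]
    exact heq' m
  refine ⟨_, fun x => synth x ((a : ℂ) • w), _, hsol,
    isQuasiPeriodic_planeWave_mul (hsol.1.differentiable (by norm_num)) (isPeriodic_synth f),
    fun x => ?_, ?_, continuous_synth _, isPeriodic_synth _, ?_, fun hA hu => hf0 ?_⟩
  · rw [psi_eq_synth, ← map_add, ← smul_add, ← ha, ← hfw, map_smul, smul_eq_mul]
    ring
  · rw [add_sub_cancel_left]
    exact (Complex.abs_re_le_norm μ).trans hμ
  · rw [starNorm_synth, norm_smul]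
    exact ENNReal.ofReal_le_ofReal ((mul_le_of_le_one_left (norm_nonneg _) hle).trans hw)
  -- As v_q ≠ 0, neither factor of the characteristic equation vanishes, hence a ≠ 0. A vanishing u
  -- would then give f = 0, against the normalisation of f along (a, b).
  · have ha0 : (a : ℂ) ≠ 0 := by
      have hmul := sub_lambdaPlus_mul (v := v) (q := q) (j := j) (t := t)
      have hw0 : 0 < ‖v q‖ := lt_trans (by positivity) hq
      have hx : pSq (j - q) t - lambdaPlus v q j t ≠ 0 := fun h => by
        rw [h, mul_zero] at hmul
        exact (pow_pos hw0 2).ne hmul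
      exact_mod_cast div_ne_zero hx (ePlusNorm_pos hvq).ne'
    refine synth_injective fun x => ?_
    rw [map_zero]
    have hx : A * a * planeWave (P j t) x * synth x f = 0 := congr_fun hu x
    have hpw : planeWave (P j t) x ≠ 0 := norm_ne_zero_iff.mp (by rw [norm_planeWave]; norm_num)
    simpa [hA, ha0, hpw] using hx

theorem isSolution_zero (V : Plane → ℂ) (σ lam : ℝ) : IsSolution V σ lam fun _ => 0 := by
  refine ⟨contDiff_const, fun x => ?_⟩
  rw [InnerProductSpace.laplacian_const]
  simp

theorem isQuasiPeriodic_zero (t : Plane) : IsQuasiPeriodic t fun _ => 0 :=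
  isQuasiPeriodic_of_translate (differentiable_const 0) fun _ _ => (mul_zero _).symm

theorem starNorm_projected_le {ε : ℝ} (hε : 0 < ε) (hε' : ε ≤ 1 / 1000) {v : Idx →₀ ℂ}
    (hv : IsRealMeanZero v) (hnorm : ‖Coeff.ofFinsupp v‖ ≤ ε ^ 9) {q j : Idx} {t : Plane}
    (hq : 0 < ‖v q‖) (hfar : ε ^ 6 ≤ |pSq j t - lambdaPlus v q j t|) :
    starNorm (fun x => synth x (-((unitFst v q j t : ℂ) •
      twoMode q (unitFst v q j t : ℂ) (unitSnd v q j t)))) ≤ ENNReal.ofReal ε := by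
  have hvq : v (-q) ≠ 0 := norm_pos_iff.mp (by rwa [hv.norm_neg])
  have ha := abs_unitFst_le hε hv ((norm_apply_le (Coeff.ofFinsupp v) q).trans hnorm) hvq hfar
  have hu := unitFst_sq_add (j := j) (t := t) hvq
  rw [starNorm_synth, norm_neg, norm_smul]
  refine ENNReal.ofReal_le_ofReal ?_
  have h1 := norm_twoMode_le q (unitFst v q j t : ℂ) (unitSnd v q j t)
  rw [Complex.norm_real, Real.norm_eq_abs] at hu h1 ⊢
  have h2 : |unitFst v q j t| + ‖unitSnd v q j t‖ ≤ 2 := by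
    nlinarith [sq_nonneg (|unitFst v q j t| - 1), sq_nonneg (‖unitSnd v q j t‖ - 1)]
  calc |unitFst v q j t| * ‖twoMode q (unitFst v q j t : ℂ) (unitSnd v q j t)‖
      ≤ ε ^ 3 * 2 := mul_le_mul ha (h1.trans h2) (norm_nonneg _) (by positivity)
    _ ≤ ε := by nlinarith [pow_pos hε 2, mul_pos hε hε]

end GrossPitaevskii

end

theorem mainTheorem2 :
    ∃ ε₀ : ℝ, 0 < ε₀ ∧ ∃ C : ℝ, 0 < C ∧
      ∀ ε : ℝ, 0 < ε → ε < ε₀ →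
      ∀ v : Idx →₀ ℂ, IsRealMeanZero v → starNorm (trigPoly v) < ENNReal.ofReal (ε ^ 9) →
      ∃ k₁ : ℝ, ∀ k : ℝ, k₁ < k →
      ∀ q : Idx, ε ^ 10 < ‖v q‖ →
      ∀ (σ : ℝ) (A : ℂ), |σ| * ‖A‖ ^ 2 < ε ^ 11 →
      ∀ t₀ ∈ resonantSet q k ε, ∀ j : Idx, IsResonantIndex q k ε t₀ j →
      ∀ t ∈ dualCell, dist t t₀ < k⁻¹ * ε ^ 7 →
      ∃ (u w : Plane → ℂ) (lam : ℝ),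
        IsSolution (trigPoly v) σ lam u ∧
        IsQuasiPeriodic t u ∧
        (∀ x, u x = A * planeWave (P j t) x * (psi v q j t x + w x)) ∧
        |lam - lambdaPlus v q j t| ≤ C * ε ^ 11 ∧
        Continuous w ∧ IsPeriodic w ∧ starNorm w ≤ ENNReal.ofReal ε ∧
        (A ≠ 0 → (∀ m, m ≠ j → m ≠ j - q → ε ^ 6 ≤ 2 * |pSq m t - lambdaPlus v q j t|) →
          u ≠ 0) := by
  refine ⟨1 / 1000, by norm_num, 9, by norm_num, fun ε hε hε' v hv hV => ⟨1, ?_⟩⟩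
  intro k hk q hq σ A hσ t₀ _ j hj t _ ht
  have hnorm : ‖Coeff.ofFinsupp v‖ ≤ ε ^ 9 := by
    rw [starNorm_trigPoly] at hV
    exact (ENNReal.ofReal_lt_ofReal_iff (by positivity)).mp hV |>.le
  by_cases hsep : ∀ m, m ≠ j → m ≠ j - q → ε ^ 6 ≤ 2 * |pSq m t - lambdaPlus v q j t|
  · obtain ⟨u, w, lam, h1, h2, h3, h4, h5, h6, h7, h8⟩ :=
      exists_solution_of_separated hε hε'.le hv hnorm hq hσ hsep
    exact ⟨u, w, lam, h1, h2, h3, h4, h5, h6, h7, fun hA _ => h8 hA⟩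
  -- Without separation from λ̂⁺ the zero solution is used, with û cancelling the small ψ_{-1}; the
  -- nonvanishing clause is then vacuous.
  · refine ⟨fun _ => 0, fun x => -psi v q j t x, lambdaPlus v q j t, isSolution_zero _ _ _,
      isQuasiPeriodic_zero t, fun x => by simp, by simp; positivity, ?_⟩
    have hw : (fun x => -psi v q j t x) = fun x => synth x (-((unitFst v q j t : ℂ) •
        Coeff.twoMode q (unitFst v q j t : ℂ) (unitSnd v q j t))) := by
      ext x
      rw [psi_eq_synth, map_neg]
    rw [hw]
    refine ⟨continuous_synth _, isPeriodic_synth _, ?_, fun _ h => absurd h hsep⟩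
    push Not at hsep
    obtain ⟨m, hm, hm', hL⟩ := hsep
    exact starNorm_projected_le hε hε'.le hv hnorm (lt_trans (by positivity) hq)
      (far_of_isResonantIndex hε hε'.le hk hj ht hm hm' hL)
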